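/- Let $P$ be an orthogonal polygon in the plane, possibly with holes: $P$ is the closed region bounded by a simple closed outer curve and finitely many (possibly zero) simple closed hole curves, all made of alternately horizontal and vertical edges, where the closed regions enclosed by the hole curves are pairwise disjoint and lie in the interior of the outer curve. Let $n$ be the total number of vertices of $P$, including the vertices of the holes. A horizontal sliding camera in $P$ is a horizontal line segment $\gamma \subseteq P$ of positive length; it sees a point $p \in P$ if there is a point $g \in \gamma$ such that the segment $pg$ is vertical (possibly of length zero) and contained in $P$. A set of cameras guards $P$ if every point of $P$ is seen by at least one of them. Then $\lfloor n/4 \rfloor$ horizontal sliding cameras are always sufficient and sometimes necessary to guard $P$. That is: 1. every orthogonal polygon with $n$ vertices (with or without holes) can be guarded by at most $\lfloor n/4\rfloor$ horizontal sliding cameras; 2. for every even $n \ge 4$ there is an orthogonal polygon with $n$ vertices and without holes such that every finite set of horizontal sliding cameras guarding it has at least $\lfloor n/4\rfloor$ elements. -/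

import Mathlib

/-! Orthogonal polygons (possibly with holes) in the plane `ℝ × ℝ`, and horizontal sliding cameras. -/

/-- The `i`-th edge, from vertex `i` to the cyclically next vertex, is horizontal. -/
def Polygon.IsHorizontalEdge {n : ℕ} (C : Polygon (ℝ × ℝ) n) (i : Fin n) : Prop :=
  (C.vertices i).2 = (C.vertices (finRotate n i)).2

/-- The `i`-th edge, from vertex `i` to the cyclically next vertex, is vertical. -/
def Polygon.IsVerticalEdge {n : ℕ} (C : Polygon (ℝ × ℝ) n) (i : Fin n) : Prop :=
  (C.vertices i).1 = (C.vertices (finRotate n i)).1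

/-- `C` is a simple closed orthogonal polygonal curve: its edges are nondegenerate, horizontal and
vertical edges alternate (so every vertex is a genuine corner), and edges that are not consecutive
are disjoint. (Consecutive edges are perpendicular, so they meet in their common vertex only.) -/
structure Polygon.IsSimpleOrthogonal {n : ℕ} (C : Polygon (ℝ × ℝ) n) : Prop where
  three_le : 3 ≤ n
  nondegenerate : C.HasNondegenerateEdges
  alternating : ∀ i : Fin n,
    (C.IsHorizontalEdge i ∧ C.IsVerticalEdge (finRotate n i)) ∨
      (C.IsVerticalEdge i ∧ C.IsHorizontalEdge (finRotate n i))
  disjoint_edges : ∀ i j : Fin n, i ≠ j → j ≠ finRotate n i → i ≠ finRotate n j →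
    Disjoint (C.edgeSet ℝ i) (C.edgeSet ℝ j)

/-- The points enclosed by the curve `C`: the union of the bounded connected components of the
complement of the curve. -/
def Polygon.inside {n : ℕ} (C : Polygon (ℝ × ℝ) n) : Set (ℝ × ℝ) :=
  {p | p ∉ C.boundary ℝ ∧ Bornology.IsBounded (connectedComponentIn (C.boundary ℝ)ᶜ p)}

/-- The curve `C` together with the points it encloses. -/
def Polygon.closedInside {n : ℕ} (C : Polygon (ℝ × ℝ) n) : Set (ℝ × ℝ) :=
  C.boundary ℝ ∪ C.inside

/-- An orthogonal polygon with finitely many (possibly no) holes: a simple orthogonal outer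
boundary curve, and simple orthogonal hole curves which lie, with the points they enclose, strictly
inside the outer curve and pairwise apart from each other. -/
structure OrthogonalPolygon where
  /-- number of vertices of the outer boundary -/
  outerCount : ℕ
  /-- the outer boundary -/
  outer : Polygon (ℝ × ℝ) outerCount
  outer_simple : outer.IsSimpleOrthogonal
  /-- number of holes -/
  numHoles : ℕ
  /-- number of vertices of each hole -/
  holeCount : Fin numHoles → ℕ
  /-- the boundary curves of the holes -/
  hole : (j : Fin numHoles) → Polygon (ℝ × ℝ) (holeCount j)
  hole_simple : ∀ j, (hole j).IsSimpleOrthogonal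
  hole_subset : ∀ j, (hole j).closedInside ⊆ outer.inside
  hole_disjoint : ∀ i j, i ≠ j → Disjoint (hole i).closedInside (hole j).closedInside

namespace OrthogonalPolygon

/-- The number of vertices of `P`, those of the holes included. -/
def numVertices (P : OrthogonalPolygon) : ℕ :=
  P.outerCount + ∑ j, P.holeCount j

/-- The open interior of `P`: what the outer curve encloses, without the holes. -/
def openRegion (P : OrthogonalPolygon) : Set (ℝ × ℝ) :=
  P.outer.inside \ ⋃ j, (P.hole j).closedInside

/-- The point set of `P`, which is closed: the interior together with the boundary. -/
def region (P : OrthogonalPolygon) : Set (ℝ × ℝ) :=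
  closure P.openRegion

end OrthogonalPolygon

/-- A horizontal line segment: the track from `(left, height)` to `(right, height)` of a horizontal
sliding camera. -/
structure HorizontalCamera where
  height : ℝ
  left : ℝ
  right : ℝ
  left_lt_right : left < right

namespace HorizontalCamera

/-- The segment along which the camera travels. -/
def track (γ : HorizontalCamera) : Set (ℝ × ℝ) :=
  segment ℝ (γ.left, γ.height) (γ.right, γ.height)

/-- The camera `γ` sees `p` in `P`: there is a point `g` of the track such that the segment from `p`
to `g` is perpendicular to the track (that is, vertical) and lies inside `P`. -/
def Sees (γ : HorizontalCamera) (P : OrthogonalPolygon) (p : ℝ × ℝ) : Prop :=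
  ∃ g ∈ γ.track, g.1 = p.1 ∧ segment ℝ p g ⊆ P.region

end HorizontalCamera

/-- The cameras in `S` run inside `P`, and every point of `P` is seen by one of them. -/
def OrthogonalPolygon.IsGuardedBy (P : OrthogonalPolygon) (S : Finset HorizontalCamera) : Prop :=
  (∀ γ ∈ S, γ.track ⊆ P.region) ∧ ∀ p ∈ P.region, ∃ γ ∈ S, γ.Sees P p

/-! ### Axis-parallel segments and cyclic sums -/

open Set Filter Topology

/-! Upper bound: let a camera run along every horizontal edge that has the polygon directly above
it. From an interior point not vertically aligned with a vertex, move down to the first boundary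
point; it lies inside such an edge, whose camera therefore sees the starting point
(`exists_edge_hit`). The remaining points are limits of these, and what a camera sees is closed, so
finitely many cameras guard everything (`exists_isGuardedBy_card_le`). The edges with the polygon
directly below serve equally well. No edge belongs to both families (`disjoint_sideEdges`), and only
half of the edges are horizontal, so the smaller family has at most a quarter as many members as
there are vertices.

The topological content is that each boundary curve has the polygon on at most one side. The full
Jordan curve theorem is not needed. Thin one-sided neighbourhoods of the edges form a connected
chain around the curve on either side, so inside or outside need only be decided near one corner,
the leftmost topmost vertex (`exists_side_sign`): a vertical ray shows that one chain is outside, a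
parity invariant that the other is inside.

Lower bound: in a comb with horizontal teeth, a vertical line of sight at the tips cannot cross the
gap between two teeth, so each tooth needs its own camera. -/

theorem mem_segment_of_snd_eq {a b p : ℝ × ℝ} (h : a.2 = b.2) :
    p ∈ segment ℝ a b ↔ p.1 ∈ uIcc a.1 b.1 ∧ p.2 = a.2 := by
  obtain ⟨a1, a2⟩ := a
  obtain ⟨b1, b2⟩ := b
  obtain ⟨p1, p2⟩ := p
  obtain rfl : a2 = b2 := h
  rw [← Prod.image_mk_segment_left, segment_eq_uIcc]
  simp only [mem_image, Prod.mk.injEq]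
  constructor
  · rintro ⟨x, hx, rfl, rfl⟩
    exact ⟨hx, rfl⟩
  · rintro ⟨hx, rfl⟩
    exact ⟨_, hx, rfl, rfl⟩

theorem mem_segment_of_fst_eq {a b p : ℝ × ℝ} (h : a.1 = b.1) :
    p ∈ segment ℝ a b ↔ p.1 = a.1 ∧ p.2 ∈ uIcc a.2 b.2 := by
  obtain ⟨a1, a2⟩ := a
  obtain ⟨b1, b2⟩ := b
  obtain ⟨p1, p2⟩ := p
  obtain rfl : a1 = b1 := h
  rw [← Prod.image_mk_segment_right, segment_eq_uIcc]
  simp only [mem_image, Prod.mk.injEq]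
  constructor
  · rintro ⟨x, hx, rfl, rfl⟩
    exact ⟨rfl, hx⟩
  · rintro ⟨rfl, hx⟩
    exact ⟨_, hx, rfl, rfl⟩

/-- A property of the indices that is inherited by the cyclic successor holds everywhere as soon as
it holds somewhere. -/
theorem finRotate_induction {n : ℕ} {p : Fin n → Prop} (h : ∀ i, p i → p (finRotate n i))
    {i : Fin n} (hi : p i) (j : Fin n) : p j := by
  obtain _ | n := n
  · exact i.elim0
  have step : ∀ k : Fin (n + 1), p (i + k) := by
    intro k
    induction k using Fin.induction with
    | zero => simpa using hi
    | succ k ih =>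
      have := h _ ih
      rwa [finRotate_apply, add_assoc, Fin.coeSucc_eq_succ] at this
  simpa using step (j - i)

/-- In characteristic two a sum whose terms agree in pairs of cyclic neighbours vanishes. -/
theorem sum_eq_zero_of_alternating {n : ℕ} {Q : Fin n → Prop}
    (hQ : ∀ i, Q (finRotate n i) ↔ ¬ Q i) {g : Fin n → ZMod 2}
    (hg : ∀ i, Q i → g i = g (finRotate n i)) : ∑ i, g i = 0 := by
  classical
  rw [← Finset.sum_filter_add_sum_filter_not Finset.univ Q]
  have : ∑ i with ¬ Q i, g i = ∑ i with Q i, g (finRotate n i) := by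
    symm
    apply Finset.sum_equiv (finRotate n)
    · intro i
      simp [hQ, -finRotate_apply]
    · intros
      rfl
  rw [this, ← Finset.sum_add_distrib]
  apply Finset.sum_eq_zero
  intro i hi
  rw [← hg i (by simpa using hi)]
  exact CharTwo.add_self_eq_zero _

/-- The rotation exchanges `Q` and its complement, so each takes half of the indices. -/
theorem card_filter_of_alternating {n : ℕ} {Q : Fin n → Prop} [DecidablePred Q]
    (hQ : ∀ i, Q (finRotate n i) ↔ ¬ Q i) : 2 * (Finset.univ.filter Q).card = n := by
  have h1 : (Finset.univ.filter Q).card = (Finset.univ.filter fun i => ¬ Q i).card := by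
    apply Finset.card_equiv (finRotate n)
    intro i
    simp [hQ, -finRotate_apply]
  have h2 := Finset.card_filter_add_card_filter_not (s := Finset.univ) Q
  simp only [Finset.card_univ, Fintype.card_fin] at h2
  omega

/-! ### Edges and vertices of a simple orthogonal curve -/

namespace Polygon

variable {n : ℕ} {C : Polygon (ℝ × ℝ) n}

theorem edgeSet_eq_segment (C : Polygon (ℝ × ℝ) n) (i : Fin n) :
    C.edgeSet ℝ i = segment ℝ (C.vertices i) (C.vertices (finRotate n i)) :=
  affineSegment_eq_segment _ _ _

theorem isCompact_edgeSet (C : Polygon (ℝ × ℝ) n) (i : Fin n) : IsCompact (C.edgeSet ℝ i) := by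
  rw [edgeSet_eq_segment, segment_eq_image_lineMap]
  exact isCompact_Icc.image AffineMap.lineMap_continuous

theorem isCompact_boundary (C : Polygon (ℝ × ℝ) n) : IsCompact (C.boundary ℝ) :=
  isCompact_iUnion fun i => C.isCompact_edgeSet i

theorem vertex_mem_edgeSet (C : Polygon (ℝ × ℝ) n) (i : Fin n) :
    C.vertices i ∈ C.edgeSet ℝ i := by
  rw [edgeSet_eq_segment]
  exact left_mem_segment _ _ _

theorem IsHorizontalEdge.mem_edgeSet {i : Fin n} (h : C.IsHorizontalEdge i) {p : ℝ × ℝ} :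
    p ∈ C.edgeSet ℝ i ↔ p.1 ∈ uIcc (C.vertices i).1 (C.vertices (finRotate n i)).1 ∧
      p.2 = (C.vertices i).2 := by
  rw [edgeSet_eq_segment, mem_segment_of_snd_eq h]

theorem IsVerticalEdge.mem_edgeSet {i : Fin n} (h : C.IsVerticalEdge i) {p : ℝ × ℝ} :
    p ∈ C.edgeSet ℝ i ↔ p.1 = (C.vertices i).1 ∧
      p.2 ∈ uIcc (C.vertices i).2 (C.vertices (finRotate n i)).2 := by
  rw [edgeSet_eq_segment, mem_segment_of_fst_eq h]

namespace IsSimpleOrthogonal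

variable (hC : C.IsSimpleOrthogonal)
include hC

theorem isVerticalEdge_iff (i : Fin n) : C.IsVerticalEdge i ↔ ¬ C.IsHorizontalEdge i := by
  constructor
  · intro h h'
    exact hC.nondegenerate i (Prod.ext h h')
  · intro h
    rcases hC.alternating i with h' | h'
    · exact absurd h'.1 h
    · exact h'.1

theorem isHorizontalEdge_rotate (i : Fin n) :
    C.IsHorizontalEdge (finRotate n i) ↔ ¬ C.IsHorizontalEdge i := by
  have := hC.isVerticalEdge_iff i
  have := hC.isVerticalEdge_iff (finRotate n i)
  rcases hC.alternating i with h' | h' <;> tauto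

theorem isVerticalEdge_rotate (i : Fin n) :
    C.IsVerticalEdge (finRotate n i) ↔ ¬ C.IsVerticalEdge i := by
  rw [hC.isVerticalEdge_iff, hC.isVerticalEdge_iff, hC.isHorizontalEdge_rotate]

theorem vertices_injective : Function.Injective C.vertices := by
  intro i j hij
  by_contra hne
  by_cases h1 : j = finRotate n i
  · exact hC.nondegenerate i (h1 ▸ hij)
  by_cases h2 : i = finRotate n j
  · exact hC.nondegenerate j (h2 ▸ hij.symm)
  exact Set.disjoint_left.1 (hC.disjoint_edges i j hne h1 h2) (C.vertex_mem_edgeSet i)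
    (hij ▸ C.vertex_mem_edgeSet j)

end IsSimpleOrthogonal

/-! ### Detecting inside and outside by parity and by rays -/

/-- The parity of the number of vertices in the closed-open quadrant to the upper left of `p`. -/
noncomputable def quadrantParity (C : Polygon (ℝ × ℝ) n) (p : ℝ × ℝ) : ZMod 2 :=
  ∑ i, if (C.vertices i).1 ≤ p.1 ∧ p.2 < (C.vertices i).2 then 1 else 0

/-- The vertices gained by moving right come in pairs, the ends of vertical edges: two such ends
have the same abscissa, and they lie on the same side of height `y` because the edge does not cross
the path. -/
theorem IsSimpleOrthogonal.quadrantParity_horizontal (hC : C.IsSimpleOrthogonal) {x x' y : ℝ}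
    (h : ∀ t ∈ uIcc x x', (t, y) ∉ C.boundary ℝ) :
    C.quadrantParity (x, y) = C.quadrantParity (x', y) := by
  wlog hx : x ≤ x' generalizing x x'
  · exact (this (by rwa [uIcc_comm]) (le_of_not_ge hx)).symm
  rw [uIcc_of_le hx] at h
  have h0 : ∑ i, (if x < (C.vertices i).1 ∧ (C.vertices i).1 ≤ x' ∧ y < (C.vertices i).2
      then (1 : ZMod 2) else 0) = 0 := by
    apply sum_eq_zero_of_alternating hC.isVerticalEdge_rotate
    intro i hi
    have h1 : (C.vertices i).1 = (C.vertices (finRotate n i)).1 := hi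
    rw [← h1]
    by_cases h2 : x < (C.vertices i).1 ∧ (C.vertices i).1 ≤ x'
    · have h3 := h _ ⟨h2.1.le, h2.2⟩
      have h4 : ¬ y ∈ uIcc (C.vertices i).2 (C.vertices (finRotate n i)).2 := fun h4 =>
        h3 (mem_iUnion.2 ⟨i, hi.mem_edgeSet.2 ⟨rfl, h4⟩⟩)
      have h5 : y < (C.vertices i).2 ↔ y < (C.vertices (finRotate n i)).2 := by
        rw [mem_uIcc] at h4
        grind
      simp only [h5]
    · rw [if_neg (by tauto), if_neg (by tauto)]
  have key : C.quadrantParity (x', y) = C.quadrantParity (x, y) + ∑ i, (if x < (C.vertices i).1 ∧ (C.vertices i).1 ≤ x' ∧ y < (C.vertices i).2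
      then (1 : ZMod 2) else 0) := by
    rw [quadrantParity, quadrantParity, ← Finset.sum_add_distrib]
    apply Finset.sum_congr rfl
    intro i _
    dsimp only
    split_ifs <;> first | rfl | grind
  rw [key, h0, add_zero]

theorem IsSimpleOrthogonal.quadrantParity_vertical (hC : C.IsSimpleOrthogonal) {x y y' : ℝ}
    (h : ∀ t ∈ uIcc y y', (x, t) ∉ C.boundary ℝ) :
    C.quadrantParity (x, y) = C.quadrantParity (x, y') := by
  wlog hy : y ≤ y' generalizing y y'
  · exact (this (by rwa [uIcc_comm]) (le_of_not_ge hy)).symm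
  rw [uIcc_of_le hy] at h
  have h0 : ∑ i, (if (C.vertices i).1 ≤ x ∧ y < (C.vertices i).2 ∧ (C.vertices i).2 ≤ y'
      then (1 : ZMod 2) else 0) = 0 := by
    apply sum_eq_zero_of_alternating hC.isHorizontalEdge_rotate
    intro i hi
    have h1 : (C.vertices i).2 = (C.vertices (finRotate n i)).2 := hi
    rw [← h1]
    by_cases h2 : y < (C.vertices i).2 ∧ (C.vertices i).2 ≤ y'
    · have h3 := h _ ⟨h2.1.le, h2.2⟩
      have h4 : ¬ x ∈ uIcc (C.vertices i).1 (C.vertices (finRotate n i)).1 := fun h4 =>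
        h3 (mem_iUnion.2 ⟨i, hi.mem_edgeSet.2 ⟨h4, rfl⟩⟩)
      have h5 : (C.vertices i).1 ≤ x ↔ (C.vertices (finRotate n i)).1 ≤ x := by
        rw [mem_uIcc] at h4
        grind
      simp only [h5]
    · rw [if_neg (by tauto), if_neg (by tauto)]
  have key : C.quadrantParity (x, y) = C.quadrantParity (x, y') + ∑ i, (if (C.vertices i).1 ≤ x ∧ y < (C.vertices i).2 ∧ (C.vertices i).2 ≤ y'
      then (1 : ZMod 2) else 0) := by
    rw [quadrantParity, quadrantParity, ← Finset.sum_add_distrib]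
    apply Finset.sum_congr rfl
    intro i _
    dsimp only
    split_ifs <;> first | rfl | grind
  rw [key, h0, add_zero]

/-- The parity is locally constant: balls of the maximum norm are squares, so inside a ball off the
curve every point is reached by one horizontal and one vertical move. -/
theorem IsSimpleOrthogonal.continuousOn_quadrantParity (hC : C.IsSimpleOrthogonal) :
    ContinuousOn C.quadrantParity (C.boundary ℝ)ᶜ := by
  intro p hp
  apply ContinuousAt.continuousWithinAt
  obtain ⟨δ, hδ, hball⟩ := Metric.isOpen_iff.1 C.isCompact_boundary.isClosed.isOpen_compl p hp
  apply (continuousAt_const (y := C.quadrantParity p)).congr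
  filter_upwards [Metric.ball_mem_nhds p hδ] with q hq
  have hx : |q.1 - p.1| < δ := lt_of_le_of_lt (le_max_left _ _) hq
  have hy : |q.2 - p.2| < δ := lt_of_le_of_lt (le_max_right _ _) hq
  have key : ∀ a b : ℝ, |a - p.1| < δ → |b - p.2| < δ → (a, b) ∉ C.boundary ℝ :=
    fun a b ha hb => hball (max_lt ha hb)
  have aux : ∀ {a b t : ℝ}, |b - a| < δ → t ∈ uIcc a b → |t - a| < δ := by
    intro a b t hab ht
    exact (abs_sub_left_of_mem_uIcc ht).trans_lt hab
  calc C.quadrantParity p = C.quadrantParity (q.1, p.2) :=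
        hC.quadrantParity_horizontal fun t ht => key _ _ (aux hx ht) (by simpa)
    _ = C.quadrantParity q :=
        hC.quadrantParity_vertical fun t ht => key _ _ hx (aux hy ht)

/-- Far to the left or far above, the quadrant contains no vertex. Far to the right the ends of each
horizontal edge cancel, far below those of each vertical edge. -/
theorem IsSimpleOrthogonal.exists_quadrantParity_eq_zero (hC : C.IsSimpleOrthogonal) :
    ∃ R : ℝ, ∀ p : ℝ × ℝ, R < ‖p‖ → C.quadrantParity p = 0 := by
  obtain ⟨R, hR⟩ := C.isCompact_boundary.isBounded.exists_norm_le
  have hv : ∀ i, |(C.vertices i).1| ≤ R ∧ |(C.vertices i).2| ≤ R := fun i =>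
    max_le_iff.1 (hR _ (mem_iUnion.2 ⟨i, C.vertex_mem_edgeSet i⟩))
  refine ⟨R, fun p hp => ?_⟩
  rcases lt_max_iff.1 hp with h | h <;> rcases lt_abs.1 h with h | h
  · apply sum_eq_zero_of_alternating hC.isHorizontalEdge_rotate
    intro i hi
    rw [show (C.vertices i).2 = (C.vertices (finRotate n i)).2 from hi]
    have h1 := (abs_le.1 (hv i).1).2
    have h2 := (abs_le.1 (hv (finRotate n i)).1).2
    simp [h1.trans h.le, h2.trans h.le, -finRotate_apply]
  · apply Finset.sum_eq_zero
    intro i _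
    have h1 := (abs_le.1 (hv i).1).1
    rw [if_neg]
    intro h3
    linarith [h3.1]
  · apply Finset.sum_eq_zero
    intro i _
    have h1 := (abs_le.1 (hv i).2).2
    rw [if_neg]
    intro h3
    linarith [h3.2]
  · apply sum_eq_zero_of_alternating hC.isVerticalEdge_rotate
    intro i hi
    rw [show (C.vertices i).1 = (C.vertices (finRotate n i)).1 from hi]
    have h1 := (abs_le.1 (hv i).2).1
    have h2 := (abs_le.1 (hv (finRotate n i)).2).1
    have h3 : p.2 < (C.vertices i).2 := by linarith
    have h4 : p.2 < (C.vertices (finRotate n i)).2 := by linarith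
    simp [h3, h4, -finRotate_apply]

/-- The parity is constant on components of the complement, and an unbounded component has points
far away, where it vanishes. The converse is not needed: points outside are recognised by unbounded
connected sets. -/
theorem IsSimpleOrthogonal.mem_inside_of_quadrantParity_ne_zero (hC : C.IsSimpleOrthogonal)
    {p : ℝ × ℝ} (hp : p ∉ C.boundary ℝ) (h : C.quadrantParity p ≠ 0) : p ∈ C.inside := by
  refine ⟨hp, ?_⟩
  by_contra hb
  obtain ⟨R, hR⟩ := hC.exists_quadrantParity_eq_zero
  have : ∃ q ∈ connectedComponentIn (C.boundary ℝ)ᶜ p, R < ‖q‖ := by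
    by_contra! hcon
    exact hb (isBounded_iff_forall_norm_le.2 ⟨R, hcon⟩)
  obtain ⟨q, hq, hq'⟩ := this
  apply h
  rw [← hR q hq']
  exact isPreconnected_connectedComponentIn.constant
    (hC.continuousOn_quadrantParity.mono (connectedComponentIn_subset _ _))
    (mem_connectedComponentIn hp) hq

theorem notMem_inside_of_not_isBounded {K : Set (ℝ × ℝ)} (hK : IsPreconnected K)
    (hKC : K ⊆ (C.boundary ℝ)ᶜ) (hb : ¬ Bornology.IsBounded K) {p : ℝ × ℝ} (hp : p ∈ K) :
    p ∉ C.inside :=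
  fun h => hb (h.2.subset (hK.subset_connectedComponentIn hp hKC))

theorem mem_inside_of_isPreconnected {K : Set (ℝ × ℝ)} (hK : IsPreconnected K)
    (hKC : K ⊆ (C.boundary ℝ)ᶜ) {p q : ℝ × ℝ} (hp : p ∈ K) (hq : q ∈ K) (h : p ∈ C.inside) :
    q ∈ C.inside := by
  refine ⟨hKC hq, ?_⟩
  rw [← connectedComponentIn_eq (hK.subset_connectedComponentIn hp hKC hq)]
  exact h.2

theorem notMem_inside_of_ray {p : ℝ × ℝ} {s : ℝ} (hs : s ≠ 0)
    (h : ∀ t : ℝ, 0 ≤ t → (p.1, p.2 + s * t) ∉ C.boundary ℝ) : p ∉ C.inside := by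
  apply notMem_inside_of_not_isBounded (K := (fun t : ℝ => (p.1, p.2 + s * t)) '' Ici 0)
  · exact (convex_Ici (0 : ℝ)).isPreconnected.image _ (by fun_prop)
  · rintro _ ⟨t, ht, rfl⟩
    exact h t ht
  · intro hb
    obtain ⟨R, hR⟩ := isBounded_iff_forall_norm_le.1 hb
    have hs' : 0 < |s| := abs_pos.2 hs
    -- Chosen so that the point at time `t` has an ordinate of absolute value at least `|R| + 1`.
    set t := (|R| + 1 + |p.2|) / |s| with ht
    have ht0 : 0 ≤ t := by positivity
    have h1 := hR _ ⟨t, ht0, rfl⟩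
    have h2 : |p.2 + s * t| ≤ R := (le_max_right _ _).trans h1
    have h3 : |s * t| = |R| + 1 + |p.2| := by
      rw [abs_mul, abs_of_nonneg ht0, ht]
      field_simp
    have h4 := abs_sub_abs_le_abs_sub (s * t) (-p.2)
    rw [abs_neg, h3, sub_neg_eq_add, add_comm (s * t)] at h4
    linarith [le_abs_self R]
  · exact ⟨0, by simp, by simp⟩

end Polygon

/-! ### Parallel curves and one-sided neighbourhoods of edges -/

theorem Real.abs_sign_le_one (x : ℝ) : |Real.sign x| ≤ 1 := by
  rcases Real.sign_apply_eq x with h | h | h <;> simp [h]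

/-- Seen from the segment between `(a, y)` and `(b, y)`, which continues vertically to `(a, y₀)` and
to `(b, y₃)`, a point of the segment parallel to it at distance `ε` lies on none of the three. -/
theorem parallel_offset_avoids {a b y y₀ y₃ σ ε p₁ p₂ : ℝ} (hab : a ≠ b) (h₀ : y₀ ≠ y)
    (h₃ : y₃ ≠ y) (hσ : σ = 1 ∨ σ = -1) (hε : 0 < ε) (hε' : 2 * ε < |b - a|)
    (hp₁ : p₁ ∈ uIcc (a - σ * ε * Real.sign (y - y₀)) (b - σ * ε * Real.sign (y₃ - y)))
    (hp₂ : p₂ = y + σ * ε * Real.sign (b - a)) :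
    p₂ ≠ y ∧ ¬ (p₁ = a ∧ p₂ ∈ uIcc y₀ y) ∧ ¬ (p₁ = b ∧ p₂ ∈ uIcc y y₃) := by
  rw [mem_uIcc] at hp₁
  simp only [mem_uIcc]
  rcases lt_or_gt_of_ne hab with h1 | h1 <;> rcases lt_or_gt_of_ne h₀ with h2 | h2 <;>
    rcases lt_or_gt_of_ne h₃ with h3 | h3
  all_goals
    first
      | rw [Real.sign_of_pos (sub_pos.2 h1), abs_of_pos (sub_pos.2 h1)] at *
      | rw [Real.sign_of_neg (sub_neg.2 h1), abs_of_neg (sub_neg.2 h1)] at *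
    first
      | rw [Real.sign_of_pos (sub_pos.2 h2)] at hp₁
      | rw [Real.sign_of_neg (sub_neg.2 h2)] at hp₁
    first
      | rw [Real.sign_of_pos (sub_pos.2 h3)] at hp₁
      | rw [Real.sign_of_neg (sub_neg.2 h3)] at hp₁
    rcases hσ with rfl | rfl <;> refine ⟨?_, ?_, ?_⟩ <;> grind

theorem lineComb_mem_uIcc {a b t : ℝ} (ht : t ∈ Icc (0 : ℝ) 1) :
    (1 - t) * a + t * b ∈ uIcc a b := by
  rw [← segment_eq_uIcc]
  exact ⟨1 - t, t, by linarith [ht.2], ht.1, by ring, by simp⟩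

namespace Polygon

variable {n : ℕ}

/-- The unit direction vector of the `i`-th edge of an orthogonal curve. -/
noncomputable def dir (C : Polygon (ℝ × ℝ) n) (i : Fin n) : ℝ × ℝ :=
  (Real.sign ((C.vertices (finRotate n i)).1 - (C.vertices i).1),
    Real.sign ((C.vertices (finRotate n i)).2 - (C.vertices i).2))

/-- The `i`-th vertex of the curve parallel to `C` at distance `ε`, to the left of `C` for `σ = 1`
and to the right for `σ = -1`. -/
noncomputable def offset (C : Polygon (ℝ × ℝ) n) (σ ε : ℝ) (i : Fin n) : ℝ × ℝ :=
  ((C.vertices i).1 - σ * ε * ((C.dir ((finRotate n).symm i)).2 + (C.dir i).2),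
    (C.vertices i).2 + σ * ε * ((C.dir ((finRotate n).symm i)).1 + (C.dir i).1))

/-- A parametrisation of the `i`-th edge of the parallel curve. -/
noncomputable def sidePoint (C : Polygon (ℝ × ℝ) n) (σ : ℝ) (i : Fin n) (q : ℝ × ℝ) : ℝ × ℝ :=
  (1 - q.1) • C.offset σ q.2 i + q.1 • C.offset σ q.2 (finRotate n i)

/-- The one-sided neighbourhood of the `i`-th edge swept by the parallel curves at distance less
than `r`. -/
def side (C : Polygon (ℝ × ℝ) n) (σ r : ℝ) (i : Fin n) : Set (ℝ × ℝ) :=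
  C.sidePoint σ i '' (Icc 0 1 ×ˢ Ioo 0 r)

variable {C : Polygon (ℝ × ℝ) n} {σ : ℝ} {i : Fin n}

theorem continuous_sidePoint : Continuous (C.sidePoint σ i) := by
  unfold sidePoint offset
  fun_prop

theorem isPreconnected_side (r : ℝ) : IsPreconnected (C.side σ r i) :=
  (((convex_Icc (0 : ℝ) 1).prod (convex_Ioo 0 r)).isPreconnected).image _
    continuous_sidePoint.continuousOn

theorem offset_mem_side {ε r : ℝ} (hε : 0 < ε) (hr : ε < r) : C.offset σ ε i ∈ C.side σ r i :=
  ⟨(0, ε), ⟨by simp, hε, hr⟩, by simp [sidePoint]⟩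

theorem offset_rotate_mem_side {ε r : ℝ} (hε : 0 < ε) (hr : ε < r) :
    C.offset σ ε (finRotate n i) ∈ C.side σ r i :=
  ⟨(1, ε), ⟨by simp, hε, hr⟩, by simp [sidePoint, -finRotate_apply]⟩

theorem sidePoint_zero (t : ℝ) : C.sidePoint σ i (t, 0) =
    (1 - t) • C.vertices i + t • C.vertices (finRotate n i) := by
  simp [sidePoint, offset, -finRotate_apply]

theorem edgeSet_subset_closure_side {r : ℝ} (hr : 0 < r) :
    C.edgeSet ℝ i ⊆ closure (C.side σ r i) := by
  intro p hp
  rw [edgeSet_eq_segment, segment_eq_image] at hp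
  obtain ⟨t, ht, rfl⟩ := hp
  dsimp only
  rw [← sidePoint_zero (σ := σ)]
  have h : Tendsto (fun ε : ℝ => C.sidePoint σ i (t, ε)) (𝓝[>] 0) (𝓝 (C.sidePoint σ i (t, 0))) :=
    ((continuous_sidePoint.comp (by fun_prop : Continuous fun ε : ℝ => (t, ε))).tendsto 0).mono_left
      nhdsWithin_le_nhds
  apply mem_closure_of_tendsto h
  filter_upwards [Ioo_mem_nhdsGT hr] with ε hε
  exact ⟨(t, ε), ⟨ht, hε⟩, rfl⟩

theorem dist_offset_le {ε : ℝ} (hσ : σ = 1 ∨ σ = -1) (hε : 0 ≤ ε) (i : Fin n) :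
    ‖C.offset σ ε i - C.vertices i‖ ≤ 2 * ε := by
  have h : ∀ a b : ℝ, |σ * ε * (Real.sign a + Real.sign b)| ≤ 2 * ε := by
    intro a b
    have h1 : |σ * ε| = ε := by rcases hσ with rfl | rfl <;> simp [abs_of_nonneg hε]
    have h2 := (abs_add_le (Real.sign a) (Real.sign b)).trans
      (add_le_add (Real.abs_sign_le_one a) (Real.abs_sign_le_one b))
    rw [abs_mul, h1]
    nlinarith
  apply max_le
  · simpa [offset, -finRotate_apply, dir] using h _ _
  · simpa [offset, -finRotate_apply, dir] using h _ _

theorem exists_dist_side_le {r : ℝ} (hσ : σ = 1 ∨ σ = -1) {p : ℝ × ℝ} (hp : p ∈ C.side σ r i) :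
    ∃ q ∈ C.edgeSet ℝ i, dist p q < 2 * r := by
  obtain ⟨⟨t, ε⟩, ⟨ht, hε⟩, rfl⟩ := hp
  simp only at ht hε
  refine ⟨(1 - t) • C.vertices i + t • C.vertices (finRotate n i), ?_, ?_⟩
  · rw [edgeSet_eq_segment]
    exact ⟨1 - t, t, by linarith [ht.2], ht.1, by ring, rfl⟩
  · have h : C.sidePoint σ i (t, ε) -
        ((1 - t) • C.vertices i + t • C.vertices (finRotate n i)) =
        (1 - t) • (C.offset σ ε i - C.vertices i) +
          t • (C.offset σ ε (finRotate n i) - C.vertices (finRotate n i)) := by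
      rw [sidePoint, smul_sub, smul_sub]
      abel
    rw [dist_eq_norm, h]
    have h1 := dist_offset_le (C := C) hσ hε.1.le i
    have h2 := dist_offset_le (C := C) hσ hε.1.le (finRotate n i)
    refine (norm_add_le _ _).trans_lt ?_
    rw [norm_smul, norm_smul, Real.norm_of_nonneg (by linarith [ht.2] : 0 ≤ 1 - t),
      Real.norm_of_nonneg ht.1]
    nlinarith [ht.1, ht.2, hε.1, hε.2]

/-- A compact edge has positive distance `ρ` from a disjoint closed set, and the side stays within
`2 * r` of the edge. -/
theorem eventually_disjoint_side {G : Set (ℝ × ℝ)} (hG : IsClosed G)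
    (h : Disjoint (C.edgeSet ℝ i) G) (hσ : σ = 1 ∨ σ = -1) :
    ∀ᶠ r in 𝓝[>] (0 : ℝ), Disjoint (C.side σ r i) G := by
  obtain ⟨ρ, hρ, hd⟩ := Metric.exists_pos_forall_lt_edist (C.isCompact_edgeSet i) hG h
  filter_upwards [Ioo_mem_nhdsGT (by positivity : (0 : ℝ) < ρ / 2)] with r hr
  rw [disjoint_left]
  intro p hp hpG
  obtain ⟨q, hq, hpq⟩ := exists_dist_side_le hσ hp
  have h1 := hd q hq p hpG
  rw [edist_nndist, ENNReal.coe_lt_coe, ← NNReal.coe_lt_coe, coe_nndist, dist_comm] at h1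
  linarith [hr.2]

theorem IsHorizontalEdge.dir_snd (h : C.IsHorizontalEdge i) : (C.dir i).2 = 0 := by
  rw [dir, show (C.vertices i).2 = (C.vertices (finRotate n i)).2 from h, sub_self, Real.sign_zero]

theorem IsVerticalEdge.dir_fst (h : C.IsVerticalEdge i) : (C.dir i).1 = 0 := by
  rw [dir, show (C.vertices i).1 = (C.vertices (finRotate n i)).1 from h, sub_self, Real.sign_zero]

namespace IsSimpleOrthogonal

variable (hC : C.IsSimpleOrthogonal)
include hC

theorem isHorizontalEdge_rotate_symm (i : Fin n) :
    C.IsHorizontalEdge ((finRotate n).symm i) ↔ ¬ C.IsHorizontalEdge i := by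
  have := hC.isHorizontalEdge_rotate ((finRotate n).symm i)
  rw [Equiv.apply_symm_apply] at this
  tauto

theorem offset_of_isHorizontalEdge (h : C.IsHorizontalEdge i) (ε : ℝ) :
    C.offset σ ε i = ((C.vertices i).1 - σ * ε * (C.dir ((finRotate n).symm i)).2,
      (C.vertices i).2 + σ * ε * (C.dir i).1) := by
  have h1 : C.IsVerticalEdge ((finRotate n).symm i) := by
    rw [hC.isVerticalEdge_iff, hC.isHorizontalEdge_rotate_symm]
    tauto
  rw [offset, h.dir_snd, h1.dir_fst, add_zero, zero_add]

theorem offset_of_isVerticalEdge (h : C.IsVerticalEdge i) (ε : ℝ) :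
    C.offset σ ε i = ((C.vertices i).1 - σ * ε * (C.dir i).2,
      (C.vertices i).2 + σ * ε * (C.dir ((finRotate n).symm i)).1) := by
  have h1 : C.IsHorizontalEdge ((finRotate n).symm i) := by
    rw [hC.isHorizontalEdge_rotate_symm, ← hC.isVerticalEdge_iff]
    exact h
  rw [offset, h.dir_fst, h1.dir_snd, add_zero, zero_add]

theorem isVerticalEdge_rotate_of_horizontal (h : C.IsHorizontalEdge i) :
    C.IsVerticalEdge (finRotate n i) := by
  rw [hC.isVerticalEdge_iff, hC.isHorizontalEdge_rotate]
  tauto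

theorem isHorizontalEdge_rotate_of_vertical (h : C.IsVerticalEdge i) :
    C.IsHorizontalEdge (finRotate n i) := by
  rwa [hC.isHorizontalEdge_rotate, ← hC.isVerticalEdge_iff]

theorem sidePoint_of_isHorizontalEdge (h : C.IsHorizontalEdge i) (t ε : ℝ) :
    C.sidePoint σ i (t, ε) =
      ((1 - t) * ((C.vertices i).1 - σ * ε * (C.dir ((finRotate n).symm i)).2) +
        t * ((C.vertices (finRotate n i)).1 - σ * ε * (C.dir (finRotate n i)).2),
      (C.vertices i).2 + σ * ε * (C.dir i).1) := by
  rw [sidePoint, hC.offset_of_isHorizontalEdge h,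
    hC.offset_of_isVerticalEdge (hC.isVerticalEdge_rotate_of_horizontal h),
    Equiv.symm_apply_apply, ← show (C.vertices i).2 = (C.vertices (finRotate n i)).2 from h]
  ext
  · simp [-finRotate_apply]
  · simp [-finRotate_apply]
    ring

theorem sidePoint_of_isVerticalEdge (h : C.IsVerticalEdge i) (t ε : ℝ) :
    C.sidePoint σ i (t, ε) = ((C.vertices i).1 - σ * ε * (C.dir i).2,
      (1 - t) * ((C.vertices i).2 + σ * ε * (C.dir ((finRotate n).symm i)).1) +
        t * ((C.vertices (finRotate n i)).2 + σ * ε * (C.dir (finRotate n i)).1)) := by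
  rw [sidePoint, hC.offset_of_isVerticalEdge h,
    hC.offset_of_isHorizontalEdge (hC.isHorizontalEdge_rotate_of_vertical h),
    Equiv.symm_apply_apply, ← show (C.vertices i).1 = (C.vertices (finRotate n i)).1 from h]
  ext
  · simp [-finRotate_apply]
    ring
  · simp [-finRotate_apply]

/-- The edge itself and its two neighbours touch the edge, so the distance argument fails and
coordinates are compared instead. The bound of half the edge length keeps the parallel edge,
shortened by at most `ε` at each end, from reversing. -/
theorem eventually_disjoint_side_adjacent (i : Fin n) (hσ : σ = 1 ∨ σ = -1) :
    ∀ᶠ r in 𝓝[>] (0 : ℝ), Disjoint (C.side σ r i) (C.edgeSet ℝ i) ∧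
      Disjoint (C.side σ r i) (C.edgeSet ℝ (finRotate n i)) ∧
      Disjoint (C.side σ r i) (C.edgeSet ℝ ((finRotate n).symm i)) := by
  set j := finRotate n i with hj
  set k := (finRotate n).symm i with hk
  have hki : finRotate n k = i := Equiv.apply_symm_apply _ _
  have hi0 := hC.nondegenerate i
  have hj0 := hC.nondegenerate j
  have hk0 := hC.nondegenerate k
  rw [← hj] at hi0
  rw [hki] at hk0
  simp only [disjoint_left, ← forall_and]
  by_cases h : C.IsHorizontalEdge i
  · have hjv : C.IsVerticalEdge j := hC.isVerticalEdge_rotate_of_horizontal h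
    have hkv : C.IsVerticalEdge k := by
      rw [hC.isVerticalEdge_iff, hk, hC.isHorizontalEdge_rotate_symm]
      tauto
    have e1 : (C.vertices i).2 = (C.vertices j).2 := h
    have e2 : (C.vertices j).1 = (C.vertices (finRotate n j)).1 := hjv
    have e3 : (C.vertices k).1 = (C.vertices (finRotate n k)).1 := hkv
    have e3' := e3
    rw [hki] at e3'
    have hne : (C.vertices i).1 ≠ (C.vertices j).1 := fun h' => hi0 (Prod.ext h' e1)
    have hpos : 0 < |(C.vertices j).1 - (C.vertices i).1| / 2 :=
      half_pos (abs_pos.2 (sub_ne_zero.2 hne.symm))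
    filter_upwards [Ioo_mem_nhdsGT hpos] with r hr p
    have main : p ∈ C.side σ r i → p.2 ≠ (C.vertices i).2 ∧
        ¬ (p.1 = (C.vertices i).1 ∧ p.2 ∈ uIcc (C.vertices k).2 (C.vertices i).2) ∧
        ¬ (p.1 = (C.vertices j).1 ∧
          p.2 ∈ uIcc (C.vertices i).2 (C.vertices (finRotate n j)).2) := by
      rintro ⟨⟨t, ε⟩, ⟨ht, hε⟩, rfl⟩
      simp only at ht hε
      apply parallel_offset_avoids (σ := σ) (ε := ε) hne (fun h' => hk0 (Prod.ext e3' h'))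
        (fun h' => hj0 (Prod.ext e2 (e1.symm.trans h'.symm))) hσ hε.1 (by linarith [hr.2, hε.2])
      · rw [hC.sidePoint_of_isHorizontalEdge h, ← hj, ← hk, dir, dir, hki, ← e1]
        exact lineComb_mem_uIcc ht
      · rw [hC.sidePoint_of_isHorizontalEdge h]
        rfl
    rw [h.mem_edgeSet, hjv.mem_edgeSet, hkv.mem_edgeSet, hki, ← e1, e3']
    tauto
  · have h : C.IsVerticalEdge i := (hC.isVerticalEdge_iff i).2 h
    have hjv : C.IsHorizontalEdge j := hC.isHorizontalEdge_rotate_of_vertical h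
    have hkv : C.IsHorizontalEdge k := by
      rwa [hk, hC.isHorizontalEdge_rotate_symm, ← hC.isVerticalEdge_iff]
    have e1 : (C.vertices i).1 = (C.vertices j).1 := h
    have e2 : (C.vertices j).2 = (C.vertices (finRotate n j)).2 := hjv
    have e3 : (C.vertices k).2 = (C.vertices (finRotate n k)).2 := hkv
    have e3' := e3
    rw [hki] at e3'
    have hne : (C.vertices i).2 ≠ (C.vertices j).2 := fun h' => hi0 (Prod.ext e1 h')
    have hpos : 0 < |(C.vertices j).2 - (C.vertices i).2| / 2 :=
      half_pos (abs_pos.2 (sub_ne_zero.2 hne.symm))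
    filter_upwards [Ioo_mem_nhdsGT hpos] with r hr p
    have main : p ∈ C.side σ r i → p.1 ≠ (C.vertices i).1 ∧
        ¬ (p.2 = (C.vertices i).2 ∧ p.1 ∈ uIcc (C.vertices k).1 (C.vertices i).1) ∧
        ¬ (p.2 = (C.vertices j).2 ∧
          p.1 ∈ uIcc (C.vertices i).1 (C.vertices (finRotate n j)).1) := by
      rintro ⟨⟨t, ε⟩, ⟨ht, hε⟩, rfl⟩
      simp only at ht hε
      -- Exchanging the coordinates reverses orientation, hence the sign of `σ`.
      apply parallel_offset_avoids (σ := -σ) (ε := ε) hne (fun h' => hk0 (Prod.ext h' e3'))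
        (fun h' => hj0 (Prod.ext (e1.symm.trans h'.symm) e2))
        (by rcases hσ with rfl | rfl <;> simp) hε.1 (by linarith [hr.2, hε.2])
      · rw [hC.sidePoint_of_isVerticalEdge h, ← hj, ← hk, dir, dir, dir, hki, ← hj, ← e1]
        simp only [neg_mul, sub_neg_eq_add]
        exact lineComb_mem_uIcc ht
      · rw [hC.sidePoint_of_isVerticalEdge h, neg_mul, neg_mul, ← sub_eq_add_neg]
        rfl
    rw [h.mem_edgeSet, hjv.mem_edgeSet, hkv.mem_edgeSet, hki, ← e1, e3']
    tauto

theorem eventually_disjoint_side_edgeSet (i j : Fin n) (hσ : σ = 1 ∨ σ = -1) :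
    ∀ᶠ r in 𝓝[>] (0 : ℝ), Disjoint (C.side σ r i) (C.edgeSet ℝ j) := by
  have h := hC.eventually_disjoint_side_adjacent i hσ
  by_cases h1 : i = j
  · exact h.mono fun r hr => h1 ▸ hr.1
  by_cases h2 : j = finRotate n i
  · exact h.mono fun r hr => h2 ▸ hr.2.1
  by_cases h3 : i = finRotate n j
  · refine h.mono fun r hr => ?_
    have := hr.2.2
    rwa [h3, Equiv.symm_apply_apply, ← h3] at this
  exact eventually_disjoint_side (C.isCompact_edgeSet j).isClosed (hC.disjoint_edges i j h1 h2 h3) hσ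

theorem eventually_disjoint_side_boundary (i : Fin n) (hσ : σ = 1 ∨ σ = -1) :
    ∀ᶠ r in 𝓝[>] (0 : ℝ), Disjoint (C.side σ r i) (C.boundary ℝ) := by
  simp only [boundary, disjoint_iUnion_right]
  exact eventually_all.2 fun j => hC.eventually_disjoint_side_edgeSet i j hσ

end IsSimpleOrthogonal

end Polygon

/-! ### Which parallel curve lies inside -/

namespace Polygon

variable {n : ℕ} {C : Polygon (ℝ × ℝ) n} {σ : ℝ} {i : Fin n}

/-- A set `A` which cannot be left without crossing `Γ` contains all sides (of the same sign) of a
curve as soon as it meets one of them. -/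
theorem side_subset_of_mem {A Γ : Set (ℝ × ℝ)} {r : ℝ} (hr : 0 < r)
    (hA : ∀ K : Set (ℝ × ℝ), IsPreconnected K → K ⊆ Γᶜ → ∀ p ∈ K, ∀ q ∈ K, p ∈ A → q ∈ A)
    (hd : ∀ i, Disjoint (C.side σ r i) Γ) {p : ℝ × ℝ} (hp : p ∈ C.side σ r i) (hpA : p ∈ A)
    (j : Fin n) : C.side σ r j ⊆ A := by
  have key : ∀ i, ∀ p ∈ C.side σ r i, p ∈ A → C.side σ r i ⊆ A := fun i p hp hpA q hq =>
    hA _ (isPreconnected_side r) (hd i).subset_compl_right p hp q hq hpA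
  -- Consecutive sides share the corner of the parallel curve at distance `r / 2`, so membership in
  -- `A` travels around the curve.
  refine finRotate_induction (p := fun i => C.side σ r i ⊆ A) ?_ (key i p hp hpA) j
  intro i hi
  exact key _ _ (offset_mem_side (half_pos hr) (half_lt_self hr))
    (hi (offset_rotate_mem_side (half_pos hr) (half_lt_self hr)))

/-- The leftmost among the topmost vertices of a curve. -/
theorem IsSimpleOrthogonal.exists_top_left (hC : C.IsSimpleOrthogonal) :
    ∃ i, ∀ j, j ≠ i → (C.vertices j).2 < (C.vertices i).2 ∨
      (C.vertices j).2 = (C.vertices i).2 ∧ (C.vertices i).1 < (C.vertices j).1 := by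
  have : Nonempty (Fin n) := ⟨⟨0, by have := hC.three_le; omega⟩⟩
  obtain ⟨i, hi⟩ := Finite.exists_max fun j => toLex ((C.vertices j).2, -(C.vertices j).1)
  refine ⟨i, fun j hj => ?_⟩
  rcases Prod.Lex.toLex_le_toLex.1 (hi j) with h | ⟨h, h'⟩
  · exact Or.inl h
  · refine Or.inr ⟨h, lt_of_le_of_ne (neg_le_neg_iff.1 h') fun h1 => hj ?_⟩
    exact hC.vertices_injective (Prod.ext h1.symm h)

/-- At the leftmost topmost vertex one parallel curve passes on the upper left, the other one on the
lower right. -/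
theorem IsSimpleOrthogonal.exists_offset_eq (hC : C.IsSimpleOrthogonal)
    (hi : ∀ j, j ≠ i → (C.vertices j).2 < (C.vertices i).2 ∨
      (C.vertices j).2 = (C.vertices i).2 ∧ (C.vertices i).1 < (C.vertices j).1) :
    ∃ σ : ℝ, (σ = 1 ∨ σ = -1) ∧ ∀ ε : ℝ,
      C.offset σ ε i = ((C.vertices i).1 - ε, (C.vertices i).2 + ε) ∧
      C.offset (-σ) ε i = ((C.vertices i).1 + ε, (C.vertices i).2 - ε) := by
  set k := (finRotate n).symm i with hk
  have hki : finRotate n k = i := Equiv.apply_symm_apply _ _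
  have hji : finRotate n i ≠ i := fun h => hC.nondegenerate i (congrArg _ h.symm)
  have hki' : k ≠ i := fun h => hji (by rwa [h] at hki)
  have hj1 := hi _ hji
  have hk1 := hi _ hki'
  by_cases h : C.IsHorizontalEdge i
  · have hkv : (C.vertices k).1 = (C.vertices (finRotate n k)).1 := by
      change C.IsVerticalEdge k
      rw [hC.isVerticalEdge_iff, hk, hC.isHorizontalEdge_rotate_symm]
      tauto
    have hh : (C.vertices i).2 = (C.vertices (finRotate n i)).2 := h
    rw [hki] at hkv
    -- The curve arrives upwards and leaves to the right, so its left faces the upper left.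
    refine ⟨1, Or.inl rfl, fun ε => ?_⟩
    rw [hC.offset_of_isHorizontalEdge h, hC.offset_of_isHorizontalEdge h, ← hk, dir, dir, hki,
      Real.sign_of_pos (by grind : 0 < (C.vertices i).2 - (C.vertices k).2),
      Real.sign_of_pos (by grind : 0 < (C.vertices (finRotate n i)).1 - (C.vertices i).1)]
    constructor <;> ext <;> simp [sub_eq_add_neg]
  · have hkv : (C.vertices k).2 = (C.vertices (finRotate n k)).2 := by
      change C.IsHorizontalEdge k
      rwa [hk, hC.isHorizontalEdge_rotate_symm]
    have h : C.IsVerticalEdge i := (hC.isVerticalEdge_iff i).2 h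
    have hh : (C.vertices i).1 = (C.vertices (finRotate n i)).1 := h
    rw [hki] at hkv
    -- The curve arrives leftwards and leaves downwards, so its right faces the upper left.
    refine ⟨-1, Or.inr rfl, fun ε => ?_⟩
    rw [hC.offset_of_isVerticalEdge h, hC.offset_of_isVerticalEdge h, ← hk, dir, dir, hki,
      Real.sign_of_neg (by grind : (C.vertices i).1 - (C.vertices k).1 < 0),
      Real.sign_of_neg (by grind : (C.vertices (finRotate n i)).2 - (C.vertices i).2 < 0)]
    constructor <;> ext <;> simp [sub_eq_add_neg]

theorem boundary_subset_of_convex {A : Set (ℝ × ℝ)} (hA : Convex ℝ A)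
    (h : ∀ i, C.vertices i ∈ A) : C.boundary ℝ ⊆ A := by
  refine iUnion_subset fun i => ?_
  rw [edgeSet_eq_segment]
  exact hA.segment_subset (h _) (h _)

/-- One of the two parallel curves lies outside a simple orthogonal curve, the other one inside. -/
theorem IsSimpleOrthogonal.exists_side_sign (hC : C.IsSimpleOrthogonal) :
    ∃ σ : ℝ, (σ = 1 ∨ σ = -1) ∧ ∀ r : ℝ, 0 < r →
      (∀ (τ : ℝ) (i : Fin n), τ = 1 ∨ τ = -1 → Disjoint (C.side τ r i) (C.boundary ℝ)) →
      ∀ i, Disjoint (C.side σ r i) C.inside ∧ C.side (-σ) r i ⊆ C.inside := by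
  obtain ⟨i, hi⟩ := hC.exists_top_left
  obtain ⟨σ, hσ, hoff⟩ := hC.exists_offset_eq hi
  refine ⟨σ, hσ, fun r hr hd j => ?_⟩
  have hσ' : -σ = 1 ∨ -σ = -1 := by rcases hσ with rfl | rfl <;> simp
  have hA : ∀ K : Set (ℝ × ℝ), IsPreconnected K → K ⊆ (C.boundary ℝ)ᶜ →
      ∀ p ∈ K, ∀ q ∈ K, p ∈ C.inside → q ∈ C.inside :=
    fun K hK hKC p hp q hq => mem_inside_of_isPreconnected hK hKC hp hq
  constructor
  · rw [disjoint_left]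
    intro p hp hpC
    have h1 := side_subset_of_mem hr hA (fun i => hd σ i hσ) hp hpC i
      (offset_mem_side (half_pos hr) (half_lt_self hr))
    rw [(hoff _).1] at h1
    -- This corner lies above the topmost vertex, so the upward ray misses the curve.
    refine notMem_inside_of_ray one_ne_zero ?_ h1
    intro t ht hmem
    have h2 : C.boundary ℝ ⊆ {q | q.2 ≤ (C.vertices i).2} := by
      apply boundary_subset_of_convex
      · exact (convex_Iic (C.vertices i).2).linear_preimage (LinearMap.snd ℝ ℝ ℝ)
      · intro j
        by_cases hj : j = i
        · simp [hj]
        · rcases hi j hj with h | h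
          · exact h.le
          · exact h.1.le
    have h3 : (C.vertices i).2 + r / 2 + 1 * t ≤ (C.vertices i).2 := h2 hmem
    linarith
  -- For small `ε` the quadrant to the upper left of the lower right corner contains no vertex but
  -- `i`, so the parity there is one.
  · have hev : ∀ᶠ ε in 𝓝[>] (0 : ℝ), ∀ j, j ≠ i →
        ¬ ((C.vertices j).1 ≤ (C.vertices i).1 + ε ∧ (C.vertices i).2 - ε < (C.vertices j).2) := by
      rw [eventually_all]
      intro j
      by_cases hj : j = i
      · simp [hj]
      rcases hi j hj with h | ⟨-, h⟩
      · filter_upwards [Ioo_mem_nhdsGT (sub_pos.2 h)] with ε hε _ h'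
        linarith [hε.2, h'.2]
      · filter_upwards [Ioo_mem_nhdsGT (sub_pos.2 h)] with ε hε _ h'
        linarith [hε.2, h'.1]
    obtain ⟨ε, hε, hεr⟩ := (hev.and (Ioo_mem_nhdsGT hr)).exists
    have hmem := offset_mem_side (C := C) (σ := -σ) (i := i) hεr.1 hεr.2
    refine side_subset_of_mem hr hA (fun i => hd _ i hσ') hmem ?_ j
    apply hC.mem_inside_of_quadrantParity_ne_zero (disjoint_left.1 (hd _ i hσ') hmem)
    rw [(hoff ε).2, quadrantParity, Finset.sum_eq_single i]
    · simp [hεr.1, hεr.1.le]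
    · intro j _ hj
      exact if_neg (hε j hj)
    · simp

theorem IsSimpleOrthogonal.dir_fst_mul_self (hC : C.IsSimpleOrthogonal)
    (h : C.IsHorizontalEdge i) : (C.dir i).1 * (C.dir i).1 = 1 := by
  have h1 : (C.vertices (finRotate n i)).1 - (C.vertices i).1 ≠ 0 := fun h' =>
    hC.nondegenerate i (Prod.ext (sub_eq_zero.1 h').symm h)
  rw [dir]
  rcases Real.sign_apply_eq_of_ne_zero _ h1 with h | h <;> simp only [h] <;> norm_num

theorem IsSimpleOrthogonal.dir_fst_eq (hC : C.IsSimpleOrthogonal) (h : C.IsHorizontalEdge i) :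
    (C.dir i).1 = 1 ∨ (C.dir i).1 = -1 :=
  mul_self_eq_one_iff.1 (hC.dir_fst_mul_self h)

/-- The points just above (`s = 1`) or below (`s = -1`) an inner point of a horizontal edge. -/
theorem IsSimpleOrthogonal.eventually_mem_side (hC : C.IsSimpleOrthogonal)
    (h : C.IsHorizontalEdge i) {x s : ℝ} (hs : s = 1 ∨ s = -1)
    (hx : x ∈ uIcc (C.vertices i).1 (C.vertices (finRotate n i)).1)
    (hx₀ : x ≠ (C.vertices i).1) (hx₁ : x ≠ (C.vertices (finRotate n i)).1) {r : ℝ} (hr : 0 < r) :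
    ∀ᶠ ε in 𝓝[>] (0 : ℝ), (x, (C.vertices i).2 + s * ε) ∈ C.side (s * (C.dir i).1) r i := by
  -- The ends of the parallel edge move by at most `ε`, so `x` remains between them while `ε` is
  -- below its distance from both ends.
  filter_upwards [Ioo_mem_nhdsGT (abs_pos.2 (sub_ne_zero.2 hx₀)),
    Ioo_mem_nhdsGT (abs_pos.2 (sub_ne_zero.2 hx₁)), Ioo_mem_nhdsGT hr] with ε h0 h1 h2
  have hσ : s * (C.dir i).1 = 1 ∨ s * (C.dir i).1 = -1 := by
    rcases hs with rfl | rfl <;> rcases hC.dir_fst_eq h with h | h <;> simp [h]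
  have hb : ∀ k, |s * (C.dir i).1 * ε * (C.dir k).2| ≤ ε := by
    intro k
    have h3 : |s * (C.dir i).1 * ε| = ε := by
      rcases hσ with h | h <;> rw [h] <;> simp [abs_of_pos h0.1]
    rw [abs_mul, h3]
    exact mul_le_of_le_one_right h0.1.le (Real.abs_sign_le_one _)
  have hu : x ∈ uIcc ((C.vertices i).1 - s * (C.dir i).1 * ε * (C.dir ((finRotate n).symm i)).2)
      ((C.vertices (finRotate n i)).1 - s * (C.dir i).1 * ε * (C.dir (finRotate n i)).2) := by
    have h3 := abs_le.1 (hb ((finRotate n).symm i))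
    have h4 := abs_le.1 (hb (finRotate n i))
    have h5 := h0.2
    have h6 := h1.2
    rw [lt_abs] at h5 h6
    rw [mem_uIcc] at hx ⊢
    rcases hx with ⟨ha, hb⟩ | ⟨ha, hb⟩
    · left
      constructor
      · rcases h5 with h5 | h5 <;> linarith
      · rcases h6 with h6 | h6 <;> linarith
    · right
      constructor
      · rcases h6 with h6 | h6 <;> linarith
      · rcases h5 with h5 | h5 <;> linarith
  rw [← segment_eq_uIcc] at hu
  obtain ⟨a, b, ha, hb, hab, hx'⟩ := hu
  refine ⟨(b, ε), ⟨⟨hb, by linarith⟩, h0.1, h2.2⟩, ?_⟩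
  rw [hC.sidePoint_of_isHorizontalEdge h]
  ext
  · rw [← hx', ← hab]
    simp only [smul_eq_mul]
    ring
  · linear_combination s * ε * hC.dir_fst_mul_self h

end Polygon

/-! ### The open region of a polygon with holes -/

namespace OrthogonalPolygon

open Polygon

variable (P : OrthogonalPolygon)

/-- The number of vertices of the outer boundary (`none`) and of the holes (`some j`). -/
def curveCount : Option (Fin P.numHoles) → ℕ
  | none => P.outerCount
  | some j => P.holeCount j

/-- The outer boundary (`none`) and the boundaries of the holes (`some j`). -/
def curve : (c : Option (Fin P.numHoles)) → Polygon (ℝ × ℝ) (P.curveCount c)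
  | none => P.outer
  | some j => P.hole j

/-- The union of all boundary curves. -/
def curves : Set (ℝ × ℝ) :=
  ⋃ c, (P.curve c).boundary ℝ

theorem curve_simple : ∀ c, (P.curve c).IsSimpleOrthogonal
  | none => P.outer_simple
  | some j => P.hole_simple j

theorem isClosed_curves : IsClosed P.curves :=
  isClosed_iUnion_of_finite fun c => (P.curve c).isCompact_boundary.isClosed

theorem disjoint_boundary_outer_hole (j : Fin P.numHoles) :
    Disjoint (P.outer.boundary ℝ) ((P.hole j).boundary ℝ) := by
  rw [disjoint_right]
  exact fun p hp => (P.hole_subset j (Or.inl hp)).1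

theorem disjoint_boundary : ∀ {c c' : Option (Fin P.numHoles)}, c ≠ c' →
    Disjoint ((P.curve c).boundary ℝ) ((P.curve c').boundary ℝ)
  | none, none, h => absurd rfl h
  | none, some j, _ => P.disjoint_boundary_outer_hole j
  | some j, none, _ => (P.disjoint_boundary_outer_hole j).symm
  | some i, some j, h => (P.hole_disjoint i j fun h' => h (congrArg some h')).mono
      subset_union_left subset_union_left

variable {P}

theorem openRegion_subset_compl_curves : P.openRegion ⊆ P.curvesᶜ := by
  intro p hp hc
  obtain ⟨c, hc⟩ := mem_iUnion.1 hc
  cases c with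
  | none => exact hp.1.1 hc
  | some j => exact hp.2 (mem_iUnion.2 ⟨j, Or.inl hc⟩)

/-- Being enclosed by a curve is constant along `K`. For the outer curve this is carried from `p` to
`q`; for a hole it is carried back, from `q` to `p`. -/
theorem mem_openRegion_of_isPreconnected (K : Set (ℝ × ℝ)) (hK : IsPreconnected K)
    (hKC : K ⊆ P.curvesᶜ) (p : ℝ × ℝ) (hp : p ∈ K) (q : ℝ × ℝ) (hq : q ∈ K)
    (h : p ∈ P.openRegion) : q ∈ P.openRegion := by
  have hsub : ∀ c, K ⊆ ((P.curve c).boundary ℝ)ᶜ := fun c x hx hx' =>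
    hKC hx (mem_iUnion.2 ⟨c, hx'⟩)
  refine ⟨mem_inside_of_isPreconnected hK (hsub none) hp hq h.1, fun hcon => h.2 ?_⟩
  obtain ⟨j, hj⟩ := mem_iUnion.1 hcon
  refine mem_iUnion.2 ⟨j, Or.inr ?_⟩
  rcases hj with hj | hj
  · exact absurd hj (hsub (some j) hq)
  · exact mem_inside_of_isPreconnected hK (hsub (some j)) hq hp hj

theorem isOpen_openRegion : IsOpen P.openRegion := by
  rw [Metric.isOpen_iff]
  intro p hp
  obtain ⟨δ, hδ, hball⟩ := Metric.isOpen_iff.1 P.isClosed_curves.isOpen_compl p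
    (openRegion_subset_compl_curves hp)
  exact ⟨δ, hδ, fun q hq => mem_openRegion_of_isPreconnected _ (convex_ball p δ).isPreconnected
    hball p (Metric.mem_ball_self hδ) q hq hp⟩

variable (P) in
/-- A distance at which the parallel curves of all boundary curves avoid all boundary curves. -/
theorem exists_side_radius : ∃ r : ℝ, 0 < r ∧ ∀ (c : Option (Fin P.numHoles)) (τ : ℝ)
    (i : Fin (P.curveCount c)), τ = 1 ∨ τ = -1 → Disjoint ((P.curve c).side τ r i) P.curves := by
  have key : ∀ τ : ℝ, τ = 1 ∨ τ = -1 → ∀ᶠ r in 𝓝[>] (0 : ℝ),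
      ∀ (c : Option (Fin P.numHoles)) (i : Fin (P.curveCount c)),
        Disjoint ((P.curve c).side τ r i) P.curves := by
    intro τ hτ
    simp only [eventually_all, curves, disjoint_iUnion_right]
    intro c i c'
    by_cases h : c = c'
    · subst h
      exact (P.curve_simple c).eventually_disjoint_side_boundary i hτ
    · exact eventually_disjoint_side (P.curve c').isCompact_boundary.isClosed
        ((P.disjoint_boundary h).mono_left (subset_iUnion _ i)) hτ
  obtain ⟨r, ⟨h1, h2⟩, hr⟩ := (((key 1 (Or.inl rfl)).and (key (-1) (Or.inr rfl))).and
    (self_mem_nhdsWithin : Ioi (0 : ℝ) ∈ 𝓝[>] 0)).exists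
  refine ⟨r, hr, fun c τ i hτ => ?_⟩
  rcases hτ with rfl | rfl
  · exact h1 c i
  · exact h2 c i

/-- Every boundary curve has a side outside the polygon. -/
theorem exists_disjoint_openRegion {r : ℝ} (hr : 0 < r)
    (hd : ∀ (c : Option (Fin P.numHoles)) (τ : ℝ) (i : Fin (P.curveCount c)), τ = 1 ∨ τ = -1 →
      Disjoint ((P.curve c).side τ r i) P.curves) (c : Option (Fin P.numHoles)) :
    ∃ σ : ℝ, (σ = 1 ∨ σ = -1) ∧ ∀ i, Disjoint ((P.curve c).side σ r i) P.openRegion := by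
  obtain ⟨σ, hσ, h⟩ := (P.curve_simple c).exists_side_sign
  have h := h r hr fun τ i hτ => (hd c τ i hτ).mono_right (subset_iUnion (fun c => (P.curve c).boundary ℝ) c)
  cases c with
  | none => exact ⟨σ, hσ, fun i => (h i).1.mono_right sdiff_subset⟩
  | some j =>
    refine ⟨-σ, by rcases hσ with rfl | rfl <;> simp, fun i => ?_⟩
    rw [disjoint_left]
    exact fun p hp hp' => hp'.2 (mem_iUnion.2 ⟨j, Or.inr ((h i).2 hp)⟩)

end OrthogonalPolygon

/-! ### Visibility -/

theorem HorizontalCamera.mem_track {γ : HorizontalCamera} {g : ℝ × ℝ} :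
    g ∈ γ.track ↔ g.1 ∈ Icc γ.left γ.right ∧ g.2 = γ.height := by
  rw [track, mem_segment_of_snd_eq (a := (γ.left, γ.height)) (b := (γ.right, γ.height)) rfl,
    uIcc_of_le γ.left_lt_right.le]

/-- For each fixed `t` the condition is the preimage of the closed region under a continuous map of
`p`; this form makes the set of visible points an intersection of closed sets. -/
theorem HorizontalCamera.sees_iff {γ : HorizontalCamera} {P : OrthogonalPolygon} {p : ℝ × ℝ} :
    γ.Sees P p ↔ p.1 ∈ Icc γ.left γ.right ∧
      ∀ t ∈ Icc (0 : ℝ) 1, (p.1, (1 - t) * p.2 + t * γ.height) ∈ P.region := by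
  have hseg : ∀ (y : ℝ), segment ℝ p (p.1, y) ⊆ P.region ↔
      ∀ t ∈ Icc (0 : ℝ) 1, (p.1, (1 - t) * p.2 + t * y) ∈ P.region := by
    intro y
    rw [segment_eq_image, image_subset_iff]
    refine forall₂_congr fun t _ => ?_
    rw [mem_preimage, show (1 - t) • p + t • (p.1, y) = (p.1, (1 - t) * p.2 + t * y) from
      Prod.ext (by simp; ring) (by simp)]
  constructor
  · rintro ⟨⟨x, y⟩, hg, hx, hsub⟩
    obtain ⟨h1, rfl⟩ := mem_track.1 hg
    obtain rfl : x = p.1 := hx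
    exact ⟨h1, (hseg _).1 hsub⟩
  · rintro ⟨hx, h⟩
    exact ⟨(p.1, γ.height), mem_track.2 ⟨hx, rfl⟩, rfl, (hseg _).2 h⟩

theorem HorizontalCamera.isClosed_setOf_sees (γ : HorizontalCamera) (P : OrthogonalPolygon) :
    IsClosed {p | γ.Sees P p} := by
  simp only [sees_iff, ofPred_and, ofPred_forall]
  refine (isClosed_Icc.preimage continuous_fst).inter (isClosed_biInter fun t _ => ?_)
  exact (isClosed_closure (s := P.openRegion)).preimage
    (by fun_prop : Continuous fun p : ℝ × ℝ => (p.1, (1 - t) * p.2 + t * γ.height))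

/-- The camera running along the horizontal segment between two points. -/
noncomputable def HorizontalCamera.ofPoints (a b : ℝ × ℝ) (h : a.1 ≠ b.1) : HorizontalCamera where
  height := a.2
  left := min a.1 b.1
  right := max a.1 b.1
  left_lt_right := min_lt_max.2 h

/-! ### The upper bound -/

namespace OrthogonalPolygon

open Polygon

variable {P : OrthogonalPolygon}

/-- Starting in a point that is not above or below a vertex and moving vertically, in the direction
`-s`, one meets a horizontal edge whose side towards `s` lies in the polygon. -/
theorem exists_edge_hit {r : ℝ} (hr : 0 < r) {p : ℝ × ℝ} (hp : p ∈ P.openRegion)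
    (hx : ∀ (c : Option (Fin P.numHoles)) (i : Fin (P.curveCount c)),
      p.1 ≠ ((P.curve c).vertices i).1) {s : ℝ} (hs : s = 1 ∨ s = -1) :
    ∃ (c : Option (Fin P.numHoles)) (i : Fin (P.curveCount c)),
      (P.curve c).IsHorizontalEdge i ∧
      p.1 ∈ uIcc ((P.curve c).vertices i).1 ((P.curve c).vertices (finRotate _ i)).1 ∧
      ((P.curve c).side (s * ((P.curve c).dir i).1) r i ∩ P.openRegion).Nonempty ∧
      ∀ t ∈ Icc (0 : ℝ) 1, (p.1, (1 - t) * p.2 + t * ((P.curve c).vertices i).2) ∈ P.region := by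
  have hs0 : s ≠ 0 := by rcases hs with rfl | rfl <;> norm_num
  have hss : s * s = 1 := by rcases hs with rfl | rfl <;> norm_num
  let f : ℝ → ℝ × ℝ := fun t => (p.1, p.2 + -s * t)
  have hf : Continuous f := by fun_prop
  have hf0 : f 0 = p := by simp [f]
  set T : Set ℝ := Ici 0 ∩ f ⁻¹' P.curves with hT
  have hTc : IsClosed T := isClosed_Ici.inter (P.isClosed_curves.preimage hf)
  have hTb : BddBelow T := ⟨0, fun t ht => ht.1⟩
  -- The outer curve encloses `p`, so the ray must meet it.
  have hTne : T.Nonempty := by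
    by_contra hne
    refine notMem_inside_of_ray (C := P.outer) (neg_ne_zero.2 hs0) (fun t ht hmem => ?_) hp.1
    exact hne ⟨t, ht, mem_iUnion.2 ⟨none, hmem⟩⟩
  set t₀ := sInf T with ht₀
  have hmem : t₀ ∈ T := hTc.csInf_mem hTne hTb
  have hpos : 0 < t₀ := by
    refine lt_of_le_of_ne hmem.1 fun h => ?_
    have h1 : f t₀ ∈ P.curves := hmem.2
    rw [← h, hf0] at h1
    exact openRegion_subset_compl_curves hp h1
  have hK : ∀ t ∈ Ico 0 t₀, f t ∈ P.openRegion := by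
    intro t ht
    refine mem_openRegion_of_isPreconnected (f '' Ico 0 t₀)
      ((convex_Ico (0 : ℝ) t₀).isPreconnected.image _ hf.continuousOn) ?_ p ⟨0, ⟨le_rfl, hpos⟩, hf0⟩
      _ ⟨t, ht, rfl⟩ hp
    rintro _ ⟨u, hu, rfl⟩ hu'
    exact absurd (csInf_le hTb ⟨hu.1, hu'⟩) (not_le.2 hu.2)
  have hK' : ∀ t ∈ Icc 0 t₀, f t ∈ P.region := by
    intro t ht
    rw [← closure_Ico hpos.ne] at ht
    exact closure_mono (image_subset_iff.2 hK) (image_closure_subset_closure_image hf ⟨t, ht, rfl⟩)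
  obtain ⟨c, hc⟩ := mem_iUnion.1 hmem.2
  obtain ⟨i, hi⟩ := mem_iUnion.1 hc
  have hC := P.curve_simple c
  -- A vertical edge would put a vertex on the vertical line through `p`.
  have hh : (P.curve c).IsHorizontalEdge i := by
    by_contra h
    exact hx c i ((((hC.isVerticalEdge_iff i).2 h).mem_edgeSet).1 hi).1
  obtain ⟨hi1, hi2⟩ := hh.mem_edgeSet.1 hi
  refine ⟨c, i, hh, hi1, ?_, ?_⟩
  -- A point of the ray just before the hit lies both in the open region and on the side of the edge
  -- towards `s`.
  · obtain ⟨ε, hε, hε'⟩ := ((hC.eventually_mem_side hh hs hi1 (hx c i) (hx c _) hr).and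
      (Ioo_mem_nhdsGT hpos)).exists
    refine ⟨_, hε, ?_⟩
    have := hK (t₀ - ε) ⟨by linarith [hε'.2], by linarith [hε'.1]⟩
    convert this using 1
    ext
    · rfl
    · rw [← hi2]
      simp only [f]
      ring
  · intro t ht
    convert hK' (t * t₀) ⟨mul_nonneg ht.1 hpos.le, mul_le_of_le_one_left hpos.le ht.2⟩ using 1
    ext
    · rfl
    · rw [← hi2]
      simp only [f]
      ring

variable (P) in
/-- The horizontal edges whose side towards `s` meets the open region. -/
def sideEdges (r s : ℝ) : Set (Σ c : Option (Fin P.numHoles), Fin (P.curveCount c)) :=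
  {e | (P.curve e.1).IsHorizontalEdge e.2 ∧
    ((P.curve e.1).side (s * ((P.curve e.1).dir e.2).1) r e.2 ∩ P.openRegion).Nonempty}

/-- The cameras along the horizontal edges with the polygon above (`s = 1`) or below (`s = -1`)
guard the polygon. -/
theorem exists_isGuardedBy_card_le {r : ℝ} (hr : 0 < r)
    (hd : ∀ (c : Option (Fin P.numHoles)) (τ : ℝ) (i : Fin (P.curveCount c)), τ = 1 ∨ τ = -1 →
      Disjoint ((P.curve c).side τ r i) P.curves) {s : ℝ} (hs : s = 1 ∨ s = -1) :
    ∃ S : Finset HorizontalCamera, S.card ≤ (P.sideEdges r s).ncard ∧ P.IsGuardedBy S := by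
  classical
  have hne : ∀ e : P.sideEdges r s, ((P.curve e.1.1).vertices e.1.2).1 ≠
      ((P.curve e.1.1).vertices (finRotate _ e.1.2)).1 := fun e h =>
    (P.curve_simple _).nondegenerate e.1.2 (Prod.ext h e.2.1)
  let cam : P.sideEdges r s → HorizontalCamera := fun e => HorizontalCamera.ofPoints _ _ (hne e)
  refine ⟨(Finset.univ : Finset (P.sideEdges r s)).image cam, ?_, ?_, ?_⟩
  · refine Finset.card_image_le.trans_eq ?_
    rw [Finset.card_univ, ← Nat.card_eq_fintype_card, Nat.card_coe_set_eq]
  · intro γ hγ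
    obtain ⟨e, -, rfl⟩ := Finset.mem_image.1 hγ
    obtain ⟨⟨c, i⟩, hh, q, hq, hq'⟩ := e
    have hC := P.curve_simple c
    have hτ : s * ((P.curve c).dir i).1 = 1 ∨ s * ((P.curve c).dir i).1 = -1 := by
      rcases hs with rfl | rfl <;> rcases hC.dir_fst_eq hh with h | h <;> simp [h]
    have h1 : (P.curve c).side (s * ((P.curve c).dir i).1) r i ⊆ P.openRegion :=
      side_subset_of_mem hr mem_openRegion_of_isPreconnected (fun i => hd c _ i hτ) hq hq' i
    refine Subset.trans ?_ ((edgeSet_subset_closure_side hr).trans (closure_mono h1))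
    intro g hg
    exact hh.mem_edgeSet.2 (HorizontalCamera.mem_track.1 hg)
  -- Only finitely many abscissae are excluded, so the admissible points are dense in the region,
  -- and the finite union of closed visible sets contains their closure.
  · let F : Set ℝ := range fun e : Σ c : Option (Fin P.numHoles), Fin (P.curveCount c) =>
      ((P.curve e.1).vertices e.2).1
    have hdense : Dense ((Prod.fst : ℝ × ℝ → ℝ) ⁻¹' Fᶜ) :=
      ((finite_range _).countable.dense_compl ℝ).preimage isOpenMap_fst
    have hclosed : IsClosed (⋃ e : P.sideEdges r s, {p | (cam e).Sees P p}) :=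
      isClosed_iUnion_of_finite fun e => (cam e).isClosed_setOf_sees P
    have hsub : P.openRegion ∩ Prod.fst ⁻¹' Fᶜ ⊆ ⋃ e : P.sideEdges r s, {p | (cam e).Sees P p} := by
      rintro p ⟨hp, hpF⟩
      obtain ⟨c, i, hh, hx, hside, hseg⟩ := exists_edge_hit hr hp
        (fun c i h => hpF ⟨⟨c, i⟩, h.symm⟩) hs
      exact mem_iUnion.2 ⟨⟨⟨c, i⟩, hh, hside⟩, HorizontalCamera.sees_iff.2 ⟨hx, hseg⟩⟩
    intro p hp
    have h1 : P.region ⊆ closure (P.openRegion ∩ Prod.fst ⁻¹' Fᶜ) :=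
      closure_minimal (hdense.open_subset_closure_inter isOpen_openRegion) isClosed_closure
    obtain ⟨e, he⟩ := mem_iUnion.1 (closure_minimal hsub hclosed (h1 hp))
    exact ⟨cam e, Finset.mem_image_of_mem _ (Finset.mem_univ _), he⟩

/-- Each horizontal edge has the polygon on at most one side. -/
theorem disjoint_sideEdges {r : ℝ} (hr : 0 < r)
    (hd : ∀ (c : Option (Fin P.numHoles)) (τ : ℝ) (i : Fin (P.curveCount c)), τ = 1 ∨ τ = -1 →
      Disjoint ((P.curve c).side τ r i) P.curves) :
    Disjoint (P.sideEdges r 1) (P.sideEdges r (-1)) := by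
  rw [disjoint_left]
  rintro ⟨c, i⟩ ⟨hh, h1⟩ ⟨-, h2⟩
  obtain ⟨σ, hσ, h⟩ := exists_disjoint_openRegion hr hd c
  have h := not_nonempty_iff_eq_empty.2 (h i).inter_eq
  simp only at h1 h2 hh
  -- Above and below the edge are its two sides `1` and `-1` in some order; one of these is `σ`,
  -- which misses the polygon.
  rcases (P.curve_simple c).dir_fst_eq hh with h3 | h3 <;> rw [h3] at h1 h2 <;>
    norm_num at h1 h2 <;> rcases hσ with rfl | rfl <;> contradiction

variable (P) in
theorem card_horizontal_edges :
    2 * {e : Σ c : Option (Fin P.numHoles), Fin (P.curveCount c) |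
      (P.curve e.1).IsHorizontalEdge e.2}.ncard = P.numVertices := by
  classical
  have h : {e : Σ c : Option (Fin P.numHoles), Fin (P.curveCount c) |
      (P.curve e.1).IsHorizontalEdge e.2} = ((Finset.univ : Finset (Option (Fin P.numHoles))).sigma
        fun c => Finset.univ.filter fun i => (P.curve c).IsHorizontalEdge i : Finset _) := by
    ext e
    simp
  rw [h, Set.ncard_coe_finset, Finset.card_sigma, Finset.mul_sum]
  simp only [card_filter_of_alternating (P.curve_simple _).isHorizontalEdge_rotate]
  rw [Fintype.sum_option]
  rfl

theorem exists_isGuardedBy (P : OrthogonalPolygon) : ∃ S : Finset HorizontalCamera,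
    S.card ≤ P.numVertices / 4 ∧ P.IsGuardedBy S := by
  obtain ⟨r, hr, hd⟩ := P.exists_side_radius
  obtain ⟨S₁, hS₁, hg₁⟩ := exists_isGuardedBy_card_le hr hd (Or.inl rfl)
  obtain ⟨S₂, hS₂, hg₂⟩ := exists_isGuardedBy_card_le hr hd (Or.inr rfl)
  have h1 := Set.ncard_union_eq (disjoint_sideEdges hr hd)
  have h2 := Set.ncard_le_ncard (union_subset (fun e he => he.1) fun e he => he.1 :
    P.sideEdges r 1 ∪ P.sideEdges r (-1) ⊆ {e | (P.curve e.1).IsHorizontalEdge e.2})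
  have h3 := P.card_horizontal_edges
  rcases le_total S₁.card S₂.card with h | h
  · exact ⟨S₁, by omega, hg₁⟩
  · exact ⟨S₂, by omega, hg₂⟩

end OrthogonalPolygon

/-! ### The lower bound: combs -/

theorem OrthogonalPolygon.region_eq_of_numHoles_eq_zero {P : OrthogonalPolygon}
    (h : P.numHoles = 0) : P.region = closure P.outer.inside := by
  have : IsEmpty (Fin P.numHoles) := h ▸ Fin.isEmpty
  simp [OrthogonalPolygon.region, OrthogonalPolygon.openRegion]

/-- The inner sides accumulate at every edge. This places the corners of the comb's teeth in its
region. -/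
theorem Polygon.IsSimpleOrthogonal.boundary_subset_closure_inside {n : ℕ}
    {C : Polygon (ℝ × ℝ) n} (hC : C.IsSimpleOrthogonal) : C.boundary ℝ ⊆ closure C.inside := by
  have h1 := eventually_all.2 fun i => hC.eventually_disjoint_side_boundary i (Or.inl rfl)
  have h2 := eventually_all.2 fun i => hC.eventually_disjoint_side_boundary i (Or.inr rfl)
  obtain ⟨r, ⟨h1, h2⟩, hr⟩ := ((h1.and h2).and (self_mem_nhdsWithin : Ioi (0 : ℝ) ∈ 𝓝[>] 0)).exists
  obtain ⟨σ, -, h⟩ := hC.exists_side_sign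
  have h := h r hr fun τ i hτ => by
    rcases hτ with rfl | rfl
    · exact h1 i
    · exact h2 i
  exact iUnion_subset fun i =>
    (Polygon.edgeSet_subset_closure_side hr).trans (closure_mono (h i).2)

theorem val_finRotate {n : ℕ} (i : Fin n) :
    (finRotate n i).val = if i.val + 1 = n then 0 else i.val + 1 := by
  obtain _ | n := n
  · exact i.elim0
  rw [coe_finRotate]
  simp [Fin.ext_iff]

/-- The vertices of a comb whose spine is on the left and whose teeth point to the right. -/
noncomputable def combVertex (N m : ℕ) : ℝ × ℝ :=
  if m + 1 = 2 * N then (0, 0) else if m + 2 = 2 * N then (0, N - 1) else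
    (if m / 2 % 2 = 0 then 2 else 1, ((m + 1) / 2 : ℕ))

/-- A comb with `2 * N` vertices and `N / 2` teeth, which occupy the heights from `2 * j` to
`2 * j + 1`. -/
noncomputable def comb (N : ℕ) : Polygon (ℝ × ℝ) (2 * N) :=
  ⟨fun i => combVertex N i⟩

/-- Vertices `2 * k` and `2 * k + 1` bound the vertical edge between heights `k` and `k + 1`: the
tip of a tooth for even `k`, the bottom of a gap for odd `k`. -/
theorem combVertex_even {N k : ℕ} (h : k + 1 < N) :
    combVertex N (2 * k) = (if k % 2 = 0 then 2 else 1, (k : ℝ)) := by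
  rw [combVertex, if_neg (by omega), if_neg (by omega), show 2 * k / 2 = k by omega,
    show (2 * k + 1) / 2 = k by omega]

theorem combVertex_odd {N k : ℕ} (h : k + 1 < N) :
    combVertex N (2 * k + 1) = (if k % 2 = 0 then 2 else 1, (k : ℝ) + 1) := by
  rw [combVertex, if_neg (by omega), if_neg (by omega), show (2 * k + 1) / 2 = k by omega,
    show (2 * k + 1 + 1) / 2 = k + 1 by omega, Nat.cast_add_one]

theorem combVertex_top {N m : ℕ} (h : m + 2 = 2 * N) : combVertex N m = (0, (N : ℝ) - 1) := by
  rw [combVertex, if_neg (by omega), if_pos h]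

theorem combVertex_bottom {N m : ℕ} (h : m + 1 = 2 * N) : combVertex N m = (0, 0) := by
  rw [combVertex, if_pos h]

theorem comb_rotate {N : ℕ} (i : Fin (2 * N)) : (comb N).vertices (finRotate _ i) =
    combVertex N (if i.val + 1 = 2 * N then 0 else i.val + 1) := by
  rw [← val_finRotate]
  rfl

/-- The end points of the edges of the comb. -/
theorem comb_edge_cases {N : ℕ} (hN : 2 ≤ N) (i : Fin (2 * N)) :
    (∃ k, i.val = 2 * k ∧ k + 1 < N ∧
      (comb N).vertices i = (if k % 2 = 0 then 2 else 1, (k : ℝ)) ∧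
      (comb N).vertices (finRotate _ i) = (if k % 2 = 0 then 2 else 1, (k : ℝ) + 1)) ∨
    (∃ k, i.val = 2 * k + 1 ∧ k + 2 < N ∧
      (comb N).vertices i = (if k % 2 = 0 then 2 else 1, (k : ℝ) + 1) ∧
      (comb N).vertices (finRotate _ i) = (if k % 2 = 0 then 1 else 2, (k : ℝ) + 1)) ∨
    (∃ k, i.val = 2 * k + 1 ∧ k + 2 = N ∧
      (comb N).vertices i = (if k % 2 = 0 then 2 else 1, (k : ℝ) + 1) ∧
      (comb N).vertices (finRotate _ i) = (0, (k : ℝ) + 1)) ∨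
    (i.val + 2 = 2 * N ∧ (comb N).vertices i = (0, (N : ℝ) - 1) ∧
      (comb N).vertices (finRotate _ i) = (0, 0)) ∨
    (i.val + 1 = 2 * N ∧ (comb N).vertices i = (0, 0) ∧
      (comb N).vertices (finRotate _ i) = (2, 0)) := by
  have hi := i.isLt
  simp only [comb_rotate]
  have hv : (comb N).vertices i = combVertex N i.val := rfl
  rw [hv]
  by_cases h1 : i.val + 1 = 2 * N
  · right; right; right; right
    refine ⟨h1, combVertex_bottom h1, ?_⟩
    rw [if_pos h1]
    simpa using combVertex_even (k := 0) (N := N) (by omega)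
  rw [if_neg h1]
  by_cases h2 : i.val + 2 = 2 * N
  · right; right; right; left
    exact ⟨h2, combVertex_top h2, combVertex_bottom (by omega)⟩
  obtain ⟨k, hk | hk⟩ := Nat.even_or_odd' i.val
  · left
    refine ⟨k, hk, by omega, ?_, ?_⟩
    · rw [hk, combVertex_even (by omega)]
    · rw [hk, combVertex_odd (by omega)]
  · right
    by_cases h3 : k + 2 = N
    · right; left
      refine ⟨k, hk, h3, ?_, ?_⟩
      · rw [hk, combVertex_odd (by omega)]
      · rw [combVertex_top (by omega), ← h3]
        push_cast
        ring_nf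
    · left
      refine ⟨k, hk, by omega, ?_, ?_⟩
      · rw [hk, combVertex_odd (by omega)]
      · rw [hk, show 2 * k + 1 + 1 = 2 * (k + 1) by ring, combVertex_even (by omega)]
        push_cast
        congr 1
        split_ifs <;> first | rfl | omega

/-- The points on the edges of the comb. -/
theorem comb_edgeSet_cases {N : ℕ} (hN : 2 ≤ N) {i : Fin (2 * N)} {p : ℝ × ℝ}
    (hp : p ∈ (comb N).edgeSet ℝ i) :
    (∃ k, i.val = 2 * k ∧ k + 1 < N ∧ p.1 = (if k % 2 = 0 then 2 else 1) ∧
      (k : ℝ) ≤ p.2 ∧ p.2 ≤ k + 1) ∨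
    (∃ k, i.val = 2 * k + 1 ∧ k + 1 < N ∧ (k + 2 < N → 1 ≤ p.1) ∧ p.2 = k + 1) ∨
    (i.val + 2 = 2 * N ∧ p.1 = 0) ∨ (i.val + 1 = 2 * N ∧ p.2 = 0) := by
  rw [Polygon.edgeSet_eq_segment] at hp
  rcases comb_edge_cases hN i with ⟨k, h1, h2, h3, h4⟩ | ⟨k, h1, h2, h3, h4⟩ |
    ⟨k, h1, h2, h3, h4⟩ | ⟨h1, h3, h4⟩ | ⟨h1, h3, h4⟩ <;> rw [h3, h4] at hp
  · replace hp := (mem_segment_of_fst_eq (by rfl)).1 hp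
    rw [uIcc_of_le (by simp)] at hp
    exact Or.inl ⟨k, h1, h2, hp.1, hp.2⟩
  · replace hp := (mem_segment_of_snd_eq (by rfl)).1 hp
    refine Or.inr (Or.inl ⟨k, h1, by omega, fun _ => ?_, hp.2⟩)
    have := hp.1
    rw [mem_uIcc] at this
    split_ifs at this <;> grind
  · replace hp := (mem_segment_of_snd_eq (by rfl)).1 hp
    exact Or.inr (Or.inl ⟨k, h1, by omega, fun _ => by omega, hp.2⟩)
  · replace hp := (mem_segment_of_fst_eq (by rfl)).1 hp
    exact Or.inr (Or.inr (Or.inl ⟨h1, hp.1⟩))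
  · replace hp := (mem_segment_of_snd_eq (by rfl)).1 hp
    exact Or.inr (Or.inr (Or.inr ⟨h1, hp.2⟩))

theorem comb_isSimpleOrthogonal {N : ℕ} (hN : 2 ≤ N) : (comb N).IsSimpleOrthogonal where
  three_le := by omega
  nondegenerate := by
    intro i h
    have hN' : (2 : ℝ) ≤ N := by exact_mod_cast hN
    rcases comb_edge_cases hN i with ⟨k, h1, h2, h3, h4⟩ | ⟨k, h1, h2, h3, h4⟩ |
      ⟨k, h1, h2, h3, h4⟩ | ⟨h1, h3, h4⟩ | ⟨h1, h3, h4⟩ <;>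
      rw [h3, h4, Prod.mk.injEq] at h
    · linarith [h.2]
    · have := h.1
      split_ifs at this <;> norm_num at this
    · have := h.1
      split_ifs at this <;> norm_num at this
    · linarith [h.2]
    · linarith [h.1]
  alternating := by
    have key : ∀ i : Fin (2 * N), (i.val % 2 = 1 → (comb N).IsHorizontalEdge i) ∧
        (i.val % 2 = 0 → (comb N).IsVerticalEdge i) := by
      intro i
      rw [Polygon.IsHorizontalEdge, Polygon.IsVerticalEdge]
      rcases comb_edge_cases hN i with ⟨k, h1, h2, h3, h4⟩ | ⟨k, h1, h2, h3, h4⟩ |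
        ⟨k, h1, h2, h3, h4⟩ | ⟨h1, h3, h4⟩ | ⟨h1, h3, h4⟩ <;> rw [h3, h4] <;>
        constructor <;> intro h <;> first | rfl | omega
    intro i
    have h := val_finRotate i
    have hi := i.isLt
    rcases Nat.mod_two_eq_zero_or_one i.val with h0 | h0
    · exact Or.inr ⟨(key i).2 h0, (key _).1 (by rw [h]; split_ifs <;> omega)⟩
    · exact Or.inl ⟨(key i).1 h0, (key _).2 (by rw [h]; split_ifs <;> omega)⟩
  disjoint_edges := by
    intro i j hij hj hi
    wlog hlt : i.val < j.val generalizing i j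
    · exact (this j i hij.symm hi hj (by have := Fin.val_ne_of_ne hij; omega)).symm
    rw [ne_eq, Fin.ext_iff, val_finRotate] at hi hj
    rw [disjoint_left]
    intro p hpi hpj
    have cast_le : ∀ a b : ℕ, (a : ℝ) ≤ b → a ≤ b := fun a b => Nat.cast_le.1
    rcases comb_edgeSet_cases hN hpi with ⟨k, h1, h2, h3, h4, h5⟩ | ⟨k, h1, h2, h3, h4⟩ |
        ⟨h1, h2⟩ | ⟨h1, h2⟩ <;>
      rcases comb_edgeSet_cases hN hpj with ⟨l, g1, g2, g3, g4, g5⟩ | ⟨l, g1, g2, g3, g4⟩ |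
        ⟨g1, g2⟩ | ⟨g1, g2⟩
    · have h6 := cast_le l (k + 1) (by push_cast; linarith)
      -- Vertical edges over successive unit intervals share a height but have different abscissae,
      -- `1` and `2`.
      obtain rfl : l = k + 1 := by omega
      rw [h3] at g3
      split_ifs at g3 <;> grind
    · have h6 := cast_le (l + 1) (k + 1) (by push_cast; linarith)
      split_ifs at hj <;> omega
    · rw [h3] at g2
      split_ifs at g2 <;> norm_num at g2
    · have h6 := cast_le k 0 (by push_cast; linarith)
      split_ifs at hi
      omega
    · have h6 := cast_le l (k + 1) (by push_cast; linarith)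
      split_ifs at hj <;> omega
    · have h6 := cast_le (l + 1) (k + 1) (by push_cast; linarith)
      omega
    · by_cases h6 : k + 2 < N
      · linarith [h3 h6]
      · split_ifs at hj <;> omega
    · have h6 := cast_le (k + 1) 0 (by push_cast; linarith)
      omega
    all_goals split_ifs at hj <;> omega

/-- The comb as an orthogonal polygon without holes. -/
noncomputable def combPolygon (N : ℕ) (hN : 2 ≤ N) : OrthogonalPolygon where
  outerCount := 2 * N
  outer := comb N
  outer_simple := comb_isSimpleOrthogonal hN
  numHoles := 0
  holeCount := fun j => j.elim0
  hole := fun j => j.elim0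
  hole_simple := fun j => j.elim0
  hole_subset := fun j => j.elim0
  hole_disjoint := fun j => j.elim0

theorem combPolygon_region {N : ℕ} (hN : 2 ≤ N) :
    (combPolygon N hN).region = closure (comb N).inside :=
  OrthogonalPolygon.region_eq_of_numHoles_eq_zero rfl

theorem tooth_mem_combPolygon_region {N : ℕ} (hN : 2 ≤ N) {j : ℕ} (hj : j < N / 2) :
    ((2 : ℝ), (2 * j : ℝ)) ∈ (combPolygon N hN).region := by
  rw [combPolygon_region]
  apply (comb_isSimpleOrthogonal hN).boundary_subset_closure_inside
  have h := (comb N).vertex_mem_edgeSet ⟨2 * (2 * j), by omega⟩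
  have h' : (comb N).vertices ⟨2 * (2 * j), by omega⟩ = ((2 : ℝ), (2 * j : ℝ)) := by
    change combVertex N (2 * (2 * j)) = _
    rw [combVertex_even (by omega), if_pos (by omega)]
    push_cast
    rfl
  exact mem_iUnion.2 ⟨_, h' ▸ h⟩

/-- The point lies in an open half-strip `W`, unbounded to the right, that misses the curve, so `W`
misses the inside and its closure. For the last tooth the strip simply lies to the right of or above
the comb. -/
theorem gap_notMem_combPolygon_region {N : ℕ} (hN : 2 ≤ N) (j : ℕ) :
    ((2 : ℝ), (2 * j + 3 / 2 : ℝ)) ∉ (combPolygon N hN).region := by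
  rw [combPolygon_region]
  set W : Set (ℝ × ℝ) := Ioi 1 ×ˢ Ioo (2 * j + 1 : ℝ) (2 * j + 2) with hW
  have hWo : IsOpen W := isOpen_Ioi.prod isOpen_Ioo
  have hWC : W ⊆ ((comb N).boundary ℝ)ᶜ := by
    rintro p ⟨hx : 1 < p.1, hy⟩ hp
    obtain ⟨i, hi⟩ := mem_iUnion.1 hp
    rw [mem_Ioo] at hy
    have cast_lt : ∀ a b : ℕ, (a : ℝ) < b → a < b := fun a b => Nat.cast_lt.1
    rcases comb_edgeSet_cases hN hi with ⟨k, h1, h2, h3, h4, h5⟩ | ⟨k, h1, h2, h3, h4⟩ |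
      ⟨h1, h2⟩ | ⟨h1, h2⟩
    · have h6 := cast_lt k (2 * j + 2) (by push_cast; linarith)
      have h7 := cast_lt (2 * j + 1) (k + 1) (by push_cast; linarith)
      rw [h3, if_neg (by omega)] at hx
      linarith
    · have h6 := cast_lt (k + 1) (2 * j + 2) (by push_cast; linarith)
      have h7 := cast_lt (2 * j + 1) (k + 1) (by push_cast; linarith)
      omega
    · linarith
    · have h7 : (0 : ℝ) ≤ j := Nat.cast_nonneg j
      linarith
  have hWd : Disjoint W (closure (comb N).inside) := by
    refine Disjoint.closure_right ?_ hWo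
    rw [disjoint_left]
    refine fun p hp => Polygon.notMem_inside_of_not_isBounded
      ((convex_Ioi 1).prod (convex_Ioo _ _)).isPreconnected hWC (fun hb => ?_) hp
    have h2 := hb.image_fst
    rw [fst_image_prod _ (nonempty_Ioo.2 (by linarith))] at h2
    exact not_bddAbove_Ioi 1 h2.bddAbove
  exact disjoint_left.1 hWd ⟨by norm_num, by constructor <;> linarith⟩

/-- The lower corners of the tooth tips are pairwise not visible from one camera: all lie at
abscissa `2`, and on that line the gap above each tooth blocks the view. -/
theorem card_ge_of_combPolygon_isGuardedBy {N : ℕ} (hN : 2 ≤ N) {S : Finset HorizontalCamera}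
    (hS : (combPolygon N hN).IsGuardedBy S) : N / 2 ≤ S.card := by
  choose γ hγS hγ using fun j : Fin (N / 2) =>
    hS.2 _ (tooth_mem_combPolygon_region hN j.isLt)
  have key : ∀ i j : Fin (N / 2), i < j → γ i ≠ γ j := by
    intro i j hij heq
    have hi := (HorizontalCamera.sees_iff.1 (hγ i)).2
    have hj := (HorizontalCamera.sees_iff.1 (hγ j)).2
    rw [← heq] at hj
    simp only at hi hj
    have hle : ((i : ℕ) : ℝ) + 1 ≤ ((j : ℕ) : ℝ) := by exact_mod_cast hij
    have hgap := gap_notMem_combPolygon_region hN i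
    have aux : ∀ a : ℝ, (∀ t ∈ Icc (0 : ℝ) 1,
        ((2 : ℝ), (1 - t) * a + t * (γ i).height) ∈ (combPolygon N hN).region) →
        (2 * ((i : ℕ) : ℝ) + 3 / 2) ∉ uIcc a (γ i).height := by
      intro a ha hmem
      rw [← segment_eq_uIcc] at hmem
      obtain ⟨u, v, hu, hv, huv, hx⟩ := hmem
      apply hgap
      rw [← hx]
      convert ha v ⟨hv, by linarith⟩ using 3
      · rw [← huv]
        simp
      · rfl
    have h1 := aux _ hi
    have h2 := aux _ hj
    rw [mem_uIcc] at h1 h2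
    -- A camera above the gap point cannot see tooth `i`; one below it cannot see tooth `j`.
    rcases le_total (2 * ((i : ℕ) : ℝ) + 3 / 2) (γ i).height with h | h
    · exact h1 (Or.inl ⟨by linarith, h⟩)
    · exact h2 (Or.inr ⟨h, by linarith⟩)
  have hinj : Function.Injective γ := by
    intro i j h
    rcases lt_trichotomy i j with hlt | heq | hlt
    · exact absurd h (key i j hlt)
    · exact heq
    · exact absurd h.symm (key j i hlt)
  simpa using Finset.card_le_card_of_injOn (s := Finset.univ) γ (fun j _ => hγS j) hinj.injOn

theorem mainTheorem7 :
    (∀ P : OrthogonalPolygon, ∃ S : Finset HorizontalCamera,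
      S.card ≤ P.numVertices / 4 ∧ P.IsGuardedBy S) ∧
    (∀ n : ℕ, 4 ≤ n → Even n → ∃ P : OrthogonalPolygon,
      P.numHoles = 0 ∧ P.numVertices = n ∧
        ∀ S : Finset HorizontalCamera, P.IsGuardedBy S → n / 4 ≤ S.card) := by
  refine ⟨OrthogonalPolygon.exists_isGuardedBy, fun n hn heven => ?_⟩
  obtain ⟨N, rfl⟩ := heven.two_dvd
  have hN : 2 ≤ N := by omega
  refine ⟨combPolygon N hN, rfl, ?_, fun S hS => ?_⟩
  · simp [OrthogonalPolygon.numVertices, combPolygon]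
  · rw [show 2 * N / 4 = N / 2 by omega]
    exact card_ge_of_combPolygon_isGuardedBy hN hS
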